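/- Let $\mathbb T=\mathbb R/\mathbb Z$ with its distance $|x-y|$ and Lebesgue measure, let $k>1$ be an integer and $f(x)=kx \bmod 1$, let $\delta\in\mathbb R$, and let $H\in C^3(\mathbb T\times\mathbb T,\mathbb R)$ satisfy $\int_{\mathbb T}H(x,y)\,dy=0$ for all $x\in\mathbb T$. For a finite nonzero Borel measure $\mu$ on $\mathbb T$ put $$g_\mu(x)=x+\frac{\delta}{\mu(\mathbb T)}\int_{\mathbb T}H(x,y)\,d\mu(y)\bmod 1,\qquad \mathcal T\mu=f_*(g_\mu)_*\mu .$$ For a positive density $\phi$, let $\mathcal T\phi$ be the continuous density of the measure $\mathcal T(\phi\,dx)$, whenever it exists. For $a,\alpha>0$ let $$\mathcal V_a=\{\phi\in C^1(\mathbb T,(0,\infty)):\ \phi(x)/\phi(y)\le e^{a|x-y|}\ \ \forall x,y\},\qquad \mathcal C_\alpha=\{\phi\in C^2(\mathbb T,(0,\infty)):\ |\phi''/\phi|\le\alpha\}.$$ For $\phi,\psi\in\mathcal V_a$ write $\phi\le_{\mathcal V_a}\psi$ if $\psi-\phi\in\mathcal V_a$, and let $$d_{\mathcal V_a}(\phi,\psi)=\log\frac{\inf\{\beta>0:\phi\le_{\mathcal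 V_a}\beta\psi\}}{\sup\{\beta>0:\beta\psi\le_{\mathcal V_a}\phi\}}\in[0,\infty]$$ be the Hilbert metric of $\mathcal V_a$ (with $\inf\emptyset=\infty$, $\sup\emptyset=0$). Suppose that $$|\delta|\,\max_{i=1,2}\ \max_{x\in\mathbb T}\|\partial_1^iH(x,\cdot)\|_{L^1(\mathbb T)}<2(k-1).$$ Then Lebesgue measure is fixed by $\mathcal T$ (so that $\mathcal T1=1$), and there are arbitrarily small $a_0,\alpha_0>0$ such that, with $U=\mathcal V_{a_0}\cap\mathcal C_{\alpha_0}$, the density $\mathcal T\phi$ exists for every $\phi\in U$, and the restriction of $\mathcal T$ to $U$ is a contraction for the Hilbert metric of $\mathcal V_{a_0}$: $\mathcal T(U)\subset U$ and there is $q\in[0,1)$ with $$d_{\mathcal V_{a_0}}(\mathcal T\phi,\mathcal T\psi)\le q\,d_{\mathcal V_{a_0}}(\phi,\psi)\qquad\text{for all }\phi,\psi\in U.$$ Moreover $1\in U$, and $d_{\mathcal V_{a_0}}(\mathcal T^n\phi,1)\to0$ as $n\to\infty$ for every $\phi\in U$; that is, Lebesgue measure is a stable fixed point of $\mathcal T$.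 -/

import Mathlib

open MeasureTheory Set Filter Topology
open scoped ENNReal

namespace SelfConsistent

/-! ### The Hilbert projective metric of a cone -/

section Hilbert

variable {E : Type*} [AddCommGroup E] [Module ℝ E]

/-- The partial ordering of a cone: `φ ≤ ψ` iff `ψ - φ ∈ V`. -/
def ConeLE (V : Set E) (φ ψ : E) : Prop := ψ - φ ∈ V

/-- `M_V(φ, ψ) = inf {β > 0 : φ ≤ β ψ}`, with value `∞` if there is no such `β`. -/
noncomputable def hilbertUpper (V : Set E) (φ ψ : E) : ℝ≥0∞ :=
  sInf {b : ℝ≥0∞ | ∃ β : ℝ, 0 < β ∧ ConeLE V φ (β • ψ) ∧ b = ENNReal.ofReal β}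

/-- `m_V(φ, ψ) = sup {β > 0 : β ψ ≤ φ}`, with value `0` if there is no such `β`. -/
noncomputable def hilbertLower (V : Set E) (φ ψ : E) : ℝ≥0∞ :=
  sSup {b : ℝ≥0∞ | ∃ β : ℝ, 0 < β ∧ ConeLE V (β • ψ) φ ∧ b = ENNReal.ofReal β}

/-- The Hilbert projective metric `d_V(φ, ψ) = log (M_V(φ, ψ) / m_V(φ, ψ))`.
It is `[0, ∞]`-valued on a cone: `∞` occurs when `M_V = ∞` or `m_V = 0`. -/
noncomputable def hilbertDist (V : Set E) (φ ψ : E) : EReal :=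
  ENNReal.log (hilbertUpper V φ ψ / hilbertLower V φ ψ)

/-- `T` restricts to a (strict, uniform) contraction of `U` into itself with respect to the
Hilbert metric of the cone `V`. -/
def IsHilbertContractionOn (V U : Set E) (T : E → E) : Prop :=
  MapsTo T U U ∧
    ∃ q : ℝ, 0 ≤ q ∧ q < 1 ∧
      ∀ φ ∈ U, ∀ ψ ∈ U, hilbertDist V (T φ) (T ψ) ≤ (q : EReal) * hilbertDist V φ ψ

end Hilbert

/-! ### Differentiation on the circle `ℝ / ℤ` -/

/-- `φ ∈ C^n(𝕋, ℝ)`: its `1`-periodic lift to the line is `C^n`. -/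
def CircleContDiff (n : ℕ) (φ : UnitAddCircle → ℝ) : Prop :=
  ContDiff ℝ n (fun t : ℝ => φ (t : UnitAddCircle))

/-- The `i`-th derivative of a function on the circle. -/
noncomputable def circleDeriv (i : ℕ) (φ : UnitAddCircle → ℝ) (x : UnitAddCircle) : ℝ :=
  iteratedDeriv i (fun t : ℝ => φ (x + (t : UnitAddCircle))) 0

/-- `H ∈ C^n(𝕋 × 𝕋, ℝ)`: its lift to the plane is `C^n`. -/
def TorusContDiff (n : ℕ) (H : UnitAddCircle → UnitAddCircle → ℝ) : Prop :=
  ContDiff ℝ n (fun p : ℝ × ℝ => H (p.1 : UnitAddCircle) (p.2 : UnitAddCircle))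

/-- `‖∂₁^i H(x, ·)‖₁`. -/
noncomputable def partialNorm (H : UnitAddCircle → UnitAddCircle → ℝ) (i : ℕ)
    (x : UnitAddCircle) : ℝ :=
  ∫ y : UnitAddCircle, |circleDeriv i (fun s => H s y) x|

/-! ### The cones -/

/-- The cone `𝒱_a` of positive `C^1` functions with `φ(x) / φ(y) ≤ exp (a |x - y|)`,
`|x - y|` being the distance on the circle. -/
def logLipCone (a : ℝ) : Set (UnitAddCircle → ℝ) :=
  {φ | CircleContDiff 1 φ ∧ (∀ x, 0 < φ x) ∧ ∀ x y, φ x / φ y ≤ Real.exp (a * dist x y)}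

/-- The convex cone `𝒞_α` of positive `C^2` functions with `|φ'' / φ| ≤ α`. -/
def secondDerivCone (α : ℝ) : Set (UnitAddCircle → ℝ) :=
  {φ | CircleContDiff 2 φ ∧ (∀ x, 0 < φ x) ∧ ∀ x, |circleDeriv 2 φ x / φ x| ≤ α}

/-! ### The self-consistent transfer operator -/

/-- The mean-field coupling map `g_μ(x) = x + δ ∫ H(x, y) dμ(y) / μ(𝕋)  mod 1`. -/
noncomputable def couplingMap (H : UnitAddCircle → UnitAddCircle → ℝ) (δ : ℝ)
    (μ : Measure UnitAddCircle) (x : UnitAddCircle) : UnitAddCircle :=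
  x + ((δ * ((∫ y, H x y ∂μ) / μ.real univ) : ℝ) : UnitAddCircle)

/-- The self-consistent transfer operator on measures, `𝒯 μ = f_* (g_μ)_* μ`. -/
noncomputable def sto (f : UnitAddCircle → UnitAddCircle)
    (H : UnitAddCircle → UnitAddCircle → ℝ) (δ : ℝ)
    (μ : Measure UnitAddCircle) : Measure UnitAddCircle :=
  (μ.map (couplingMap H δ μ)).map f

/-- The measure with density `φ` with respect to Lebesgue measure. -/
noncomputable def densityMeasure (φ : UnitAddCircle → ℝ) : Measure UnitAddCircle :=
  volume.withDensity (fun x => ENNReal.ofReal (φ x))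

/-- The self-consistent transfer operator on densities: `stoDensity f H δ φ` is the continuous
density of `𝒯(φ dx)` (which is unique when it exists; the value is unspecified otherwise). -/
noncomputable def stoDensity (f : UnitAddCircle → UnitAddCircle)
    (H : UnitAddCircle → UnitAddCircle → ℝ) (δ : ℝ)
    (φ : UnitAddCircle → ℝ) : UnitAddCircle → ℝ :=
  Classical.epsilon fun ψ : UnitAddCircle → ℝ =>
    Continuous ψ ∧ (∀ x, 0 ≤ ψ x) ∧ sto f H δ (densityMeasure φ) = densityMeasure ψ

/-- The map `x ↦ k x mod 1` of the circle. -/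
def multMap (k : ℕ) (x : UnitAddCircle) : UnitAddCircle := k • x

end SelfConsistent

namespace SelfConsistent

/-! ### Hilbert metric and a contraction criterion without linearity -/

section Cone

variable {E : Type*} [AddCommGroup E] [Module ℝ E] {V U : Set E} {T : E → E}

/-! The operator is nonlinear, so Birkhoff's theorem is replaced by a direct improvement argument.
Let `I` be the ratio of the masses of `φ` and `ψ`. If `β ψ ≤ φ` always implies `(β + κ (I - β)) Tψ ≤
Tφ`, then weighted AM-GM gives `m(Tφ, Tψ) ≥ I ^ κ m(φ, ψ) ^ (1 - κ)`. Multiplying by the same bound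
with the roles exchanged cancels `I`, and the metric shrinks by the factor `1 - κ`
(`hilbertDist_image_le`).

To improve `β`, lift to the line and normalise to periodic probability densities `p`, `q`.
Membership in `𝒱_a` becomes `|p'| ≤ a p`. Suppose `p - β q` is in the cone and put `r = 1 - β`, its
mass. On a circle of diameter `1/2`, it differs from `r` by at most about `r a / 2`
(`abs_sub_mass_le`). As `H` has mean zero, fields see only this oscillation: the second derivative
of the field of `p - β q` is at most about `Θ r a / 2`, where `Θ` bounds `|δ| ‖∂₁² H(x, ·)‖₁`. Hence
coupling turns the derivative bound `a r` into `a r (1 + Θ / 2)` to leading order, and averaging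
over the inverse branches divides it by `k`. The assumption `Θ < 2 (k - 1)` says exactly that `(1 +
Θ / 2) / k < 1`.

Since `p` and `q` are moved by different fields, error terms appear. Both `p - q` and the difference
of the fields are `O(r a)`, and the fields themselves are `O(a)`; with second derivatives controlled
by `α = (4 N + 1) a`, every error in the derivative is `O(r a²)`, negligible for small `a`
(`LineDensity.shift_combination_bounds`). The image of `p - β q` thus lies strictly inside the cone,
which leaves room to subtract a further multiple of the image of `q` (`LineDensity.lineOp_improve`).
-/

theorem coneLE_inv_smul_iff (hV : ∀ c : ℝ, 0 < c → ∀ φ ∈ V, c • φ ∈ V) {β : ℝ} (hβ : 0 < β)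
    (φ ψ : E) : ConeLE V (β⁻¹ • φ) ψ ↔ ConeLE V φ (β • ψ) := by
  have key : β • (ψ - β⁻¹ • φ) = β • ψ - φ := by
    rw [smul_sub, smul_smul, mul_inv_cancel₀ hβ.ne', one_smul]
  constructor
  · intro h
    have := hV β hβ _ h
    rwa [key] at this
  · intro h
    have := hV β⁻¹ (inv_pos.2 hβ) _ h
    rwa [← key, smul_smul, inv_mul_cancel₀ hβ.ne', one_smul] at this

/-- Inverting `β` exchanges the two order relations, and the conventions for empty sets match
because `0⁻¹ = ∞` in `ℝ≥0∞`. From here on only lower bounds need to be tracked. -/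
theorem hilbertUpper_eq_inv_hilbertLower (hV : ∀ c : ℝ, 0 < c → ∀ φ ∈ V, c • φ ∈ V) (φ ψ : E) :
    hilbertUpper V φ ψ = (hilbertLower V ψ φ)⁻¹ := by
  unfold hilbertUpper hilbertLower
  rw [ENNReal.inv_sSup, sInf_eq_iInf]
  apply le_antisymm
  · refine le_iInf₂ fun b hb => ?_
    obtain ⟨β, hβ, h, rfl⟩ := hb
    refine iInf₂_le_of_le (ENNReal.ofReal β)⁻¹ ?_ le_rfl
    refine ⟨β⁻¹, inv_pos.2 hβ, ?_, (ENNReal.ofReal_inv_of_pos hβ).symm⟩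
    rw [← coneLE_inv_smul_iff hV (inv_pos.2 hβ), inv_inv]
    exact h
  · refine le_iInf₂ fun b hb => ?_
    obtain ⟨β, hβ, h, rfl⟩ := hb
    refine iInf₂_le_of_le (ENNReal.ofReal β)⁻¹ ?_ (by rw [inv_inv])
    refine ⟨β⁻¹, inv_pos.2 hβ, ?_, (ENNReal.ofReal_inv_of_pos hβ).symm⟩
    rwa [coneLE_inv_smul_iff hV hβ]

theorem hilbertDist_eq (hV : ∀ c : ℝ, 0 < c → ∀ φ ∈ V, c • φ ∈ V) (φ ψ : E) :
    hilbertDist V φ ψ = ENNReal.log ((hilbertLower V ψ φ)⁻¹ * (hilbertLower V φ ψ)⁻¹) := by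
  rw [hilbertDist, hilbertUpper_eq_inv_hilbertLower hV, div_eq_mul_inv]

theorem hilbertLower_le {I : ℝ} (φ ψ : E)
    (h : ∀ β : ℝ, 0 < β → ConeLE V (β • ψ) φ → β ≤ I) :
    hilbertLower V φ ψ ≤ ENNReal.ofReal I := by
  refine sSup_le ?_
  rintro b ⟨β, hβ, hc, rfl⟩
  exact ENNReal.ofReal_le_ofReal (h β hβ hc)

theorem ofReal_le_hilbertLower {β : ℝ} (hβ : 0 < β) {φ ψ : E} (h : ConeLE V (β • ψ) φ) :
    ENNReal.ofReal β ≤ hilbertLower V φ ψ :=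
  le_sSup ⟨β, hβ, h, rfl⟩

/-- If every `β` with `β ψ ≤ φ` can be improved to `β + κ (I - β)` for the images, then
`m(Tφ, Tψ) ≥ I ^ κ m(φ, ψ) ^ (1 - κ)`. -/
theorem hilbertLower_image_inv_le {κ I : ℝ} (hκ : 0 < κ) (hκ1 : κ < 1) (hI : 0 < I) {φ ψ φ' ψ' : E}
    (h : ∀ β : ℝ, 0 < β → ConeLE V (β • ψ) φ → β ≤ I ∧ ConeLE V ((β + κ * (I - β)) • ψ') φ') :
    (hilbertLower V φ' ψ')⁻¹ ≤
      (ENNReal.ofReal I)⁻¹ ^ κ * (hilbertLower V φ ψ)⁻¹ ^ (1 - κ) := by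
  have hI0 : ENNReal.ofReal I ≠ 0 := by simpa using hI
  have hIt : ENNReal.ofReal I ≠ ∞ := ENNReal.ofReal_ne_top
  set L' := hilbertLower V φ' ψ'
  -- With the power moved to the right, a supremum is bounded term by term, and the values `0` and
  -- `∞` need no separate cases.
  have h1 : hilbertLower V φ ψ ≤ (L' * (ENNReal.ofReal I ^ κ)⁻¹) ^ (1 - κ)⁻¹ := by
    refine sSup_le ?_
    rintro b ⟨β, hβ, hc, rfl⟩
    obtain ⟨hle, hc'⟩ := h β hβ hc
    have hβ' : 0 < β + κ * (I - β) := by nlinarith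
    have h2 := ofReal_le_hilbertLower hβ' hc'
    rw [ENNReal.le_rpow_inv_iff (by linarith), ← div_eq_mul_inv, ENNReal.le_div_iff_mul_le]
    · refine le_trans ?_ h2
      rw [ENNReal.ofReal_rpow_of_pos hI, ENNReal.ofReal_rpow_of_pos hβ,
        ← ENNReal.ofReal_mul (by positivity)]
      apply ENNReal.ofReal_le_ofReal
      -- The improved coefficient `β + κ (I - β)` is the weighted arithmetic mean of `β` and `I`,
      -- hence at least `β ^ (1 - κ) * I ^ κ`.
      have := Real.geom_mean_le_arith_mean2_weighted (w₁ := 1 - κ) (w₂ := κ) (p₁ := β) (p₂ := I)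
        (by linarith) hκ.le hβ.le hI.le (by ring)
      linarith
    · left; simp [hI0, hIt]
    · left; simp [hI0, hIt]
  rw [ENNReal.le_rpow_inv_iff (by linarith)] at h1
  have h3 := ENNReal.inv_le_inv.2 h1
  have hP0 : ENNReal.ofReal I ^ κ ≠ 0 := by simp [hI0, hIt]
  have hPt : ENNReal.ofReal I ^ κ ≠ ∞ := by simp [hI0, hIt]
  rw [ENNReal.mul_inv (Or.inr (by simp [hP0])) (Or.inr (by simp [hPt])), inv_inv] at h3
  rw [ENNReal.inv_rpow, ENNReal.inv_rpow]
  calc L'⁻¹ = (ENNReal.ofReal I ^ κ)⁻¹ * (L'⁻¹ * ENNReal.ofReal I ^ κ) := by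
        rw [mul_comm L'⁻¹, ← mul_assoc, ENNReal.inv_mul_cancel hP0 hPt, one_mul]
    _ ≤ _ := by gcongr

/-- A criterion for contraction in the Hilbert metric, for maps that need not be linear. -/
theorem hilbertDist_image_le {κ : ℝ} (hκ : 0 < κ) (hκ1 : κ < 1)
    (hV : ∀ c : ℝ, 0 < c → ∀ φ ∈ V, c • φ ∈ V) {I : ℝ} (hI : 0 < I) {φ ψ φ' ψ' : E}
    (h₁ : ∀ β : ℝ, 0 < β → ConeLE V (β • ψ) φ →
      β ≤ I ∧ ConeLE V ((β + κ * (I - β)) • ψ') φ')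
    (h₂ : ∀ β : ℝ, 0 < β → ConeLE V (β • φ) ψ →
      β ≤ I⁻¹ ∧ ConeLE V ((β + κ * (I⁻¹ - β)) • φ') ψ') :
    hilbertDist V φ' ψ' ≤ ((1 - κ : ℝ) : EReal) * hilbertDist V φ ψ := by
  rw [hilbertDist_eq hV, hilbertDist_eq hV, ← ENNReal.log_rpow]
  apply ENNReal.log_le_log
  have e₁ := hilbertLower_image_inv_le hκ hκ1 hI h₁
  have e₂ := hilbertLower_image_inv_le hκ hκ1 (inv_pos.2 hI) h₂
  have hI0 : ENNReal.ofReal I ≠ 0 := by simpa using hI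
  have hIt : ENNReal.ofReal I ≠ ∞ := ENNReal.ofReal_ne_top
  rw [ENNReal.mul_rpow_of_nonneg _ _ (by linarith)]
  refine (mul_le_mul' e₂ e₁).trans ?_
  rw [ENNReal.ofReal_inv_of_pos hI, inv_inv, ENNReal.inv_rpow (ENNReal.ofReal I)]
  have hP0 : ENNReal.ofReal I ^ κ ≠ 0 := by simp [hI0, hIt]
  have hPt : ENNReal.ofReal I ^ κ ≠ ∞ := by simp [hI0, hIt]
  rw [mul_mul_mul_comm, ENNReal.mul_inv_cancel hP0 hPt, one_mul]

/-- The mass bounds make the product of the two lower constants at most `1`. The logarithm takes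
values in `EReal`, so this sign has to be known before passing to real numbers. -/
theorem hilbertDist_nonneg_of_le (hV : ∀ c : ℝ, 0 < c → ∀ φ ∈ V, c • φ ∈ V) {I : ℝ} (hI : 0 < I)
    {φ ψ : E} (h₁ : ∀ β : ℝ, 0 < β → ConeLE V (β • ψ) φ → β ≤ I)
    (h₂ : ∀ β : ℝ, 0 < β → ConeLE V (β • φ) ψ → β ≤ I⁻¹) :
    0 ≤ hilbertDist V φ ψ := by
  rw [hilbertDist_eq hV, ← ENNReal.log_one]
  apply ENNReal.log_le_log
  have e₁ := ENNReal.inv_le_inv.2 (hilbertLower_le φ ψ h₁)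
  have e₂ := ENNReal.inv_le_inv.2 (hilbertLower_le ψ φ h₂)
  have hI0 : ENNReal.ofReal I ≠ 0 := by simpa using hI
  refine le_trans ?_ (mul_le_mul' e₂ e₁)
  rw [ENNReal.ofReal_inv_of_pos hI, inv_inv, ENNReal.mul_inv_cancel hI0 ENNReal.ofReal_ne_top]

theorem hilbertDist_lt_top (hV : ∀ c : ℝ, 0 < c → ∀ φ ∈ V, c • φ ∈ V) {φ ψ : E} {β γ : ℝ}
    (hβ : 0 < β) (hγ : 0 < γ) (h₁ : ConeLE V (β • ψ) φ) (h₂ : ConeLE V (γ • φ) ψ) :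
    hilbertDist V φ ψ < ⊤ := by
  rw [hilbertDist_eq hV]
  have e₁ := ENNReal.inv_le_inv.2 (ofReal_le_hilbertLower hβ h₁)
  have e₂ := ENNReal.inv_le_inv.2 (ofReal_le_hilbertLower hγ h₂)
  rw [lt_top_iff_ne_top, Ne, ENNReal.log_eq_top_iff]
  refine ne_top_of_le_ne_top ?_ (mul_le_mul' e₂ e₁)
  exact ENNReal.mul_ne_top (by simpa using hγ) (by simpa using hβ)

/-- If every `β` with `β ψ ≤ φ` can be improved for the images, then `T` is a contraction;
`I` plays the role of the mass. -/
theorem isHilbertContractionOn_of_improve {κ : ℝ} (hκ : 0 < κ) (hκ1 : κ < 1)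
    (hV : ∀ c : ℝ, 0 < c → ∀ φ ∈ V, c • φ ∈ V) (I : E → ℝ) (hI : ∀ φ ∈ U, 0 < I φ)
    (hmaps : MapsTo T U U)
    (hlt : ∀ φ ∈ U, ∀ ψ ∈ U, ∀ β : ℝ, 0 < β → ConeLE V (β • ψ) φ → β ≤ I φ / I ψ)
    (himp : ∀ φ ∈ U, ∀ ψ ∈ U, ∀ β : ℝ, 0 < β → ConeLE V (β • ψ) φ →
      ConeLE V ((β + κ * (I φ / I ψ - β)) • T ψ) (T φ)) :
    IsHilbertContractionOn V U T := by
  refine ⟨hmaps, 1 - κ, by linarith, by linarith, fun φ hφ ψ hψ => ?_⟩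
  have hpos : 0 < I φ / I ψ := div_pos (hI φ hφ) (hI ψ hψ)
  refine hilbertDist_image_le hκ hκ1 hV hpos
    (fun β hβ h => ⟨hlt φ hφ ψ hψ β hβ h, himp φ hφ ψ hψ β hβ h⟩) ?_
  rw [inv_div]
  exact fun β hβ h => ⟨hlt ψ hψ φ hφ β hβ h, himp ψ hψ φ hφ β hβ h⟩

/-- Geometric decay towards the fixed point; `hfin` is needed because a contraction gives nothing
when the initial distance is infinite. -/
theorem tendsto_hilbertDist_iterate (hV : ∀ c : ℝ, 0 < c → ∀ φ ∈ V, c • φ ∈ V) (I : E → ℝ)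
    (hI : ∀ φ ∈ U, 0 < I φ)
    (hlt : ∀ φ ∈ U, ∀ ψ ∈ U, ∀ β : ℝ, 0 < β → ConeLE V (β • ψ) φ → β ≤ I φ / I ψ)
    (hT : IsHilbertContractionOn V U T)
    (hfin : ∀ φ ∈ U, ∀ ψ ∈ U, hilbertDist V (T φ) (T ψ) < ⊤)
    {e : E} (he : e ∈ U) (hTe : T e = e) {φ : E} (hφ : φ ∈ U) :
    Tendsto (fun n : ℕ => hilbertDist V (T^[n] φ) e) atTop (𝓝 0) := by
  obtain ⟨hmaps, q, hq0, hq1, hq⟩ := hT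
  have hmem : ∀ n, T^[n] φ ∈ U := fun n => hmaps.iterate n hφ
  have hnn : ∀ n, 0 ≤ hilbertDist V (T^[n] φ) e := fun n => by
    refine hilbertDist_nonneg_of_le hV (div_pos (hI _ (hmem n)) (hI e he))
      (hlt _ (hmem n) e he) ?_
    rw [inv_div]
    exact hlt e he _ (hmem n)
  -- The distance from `φ` itself may be infinite; it is finite after one application of `T`, so the
  -- sequence starts there.
  rw [← tendsto_add_atTop_iff_nat 1]
  have h0 : ∀ n, hilbertDist V (T^[n + 1] φ) e ≠ ⊤ := fun n => by
    rw [Function.iterate_succ_apply']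
    have := hfin _ (hmem n) e he
    rw [hTe] at this
    exact this.ne
  have hreal : ∀ n, ((hilbertDist V (T^[n + 1] φ) e).toReal : EReal)
      = hilbertDist V (T^[n + 1] φ) e := fun n =>
    EReal.coe_toReal (h0 n) (ne_bot_of_le_ne_bot EReal.zero_ne_bot (hnn _))
  set x : ℕ → ℝ := fun n => (hilbertDist V (T^[n + 1] φ) e).toReal with hx
  have hx0 : ∀ n, 0 ≤ x n := fun n => by
    have := hnn (n + 1)
    rw [← hreal n] at this
    exact_mod_cast this
  have hstep : ∀ n, x (n + 1) ≤ q * x n := fun n => by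
    have := hq _ (hmem (n + 1)) e he
    rw [hTe, ← Function.iterate_succ_apply' T, ← hreal (n + 1), ← hreal n, ← EReal.coe_mul] at this
    exact_mod_cast this
  have hgeo : ∀ n, x n ≤ q ^ n * x 0 := fun n => by
    induction n with
    | zero => simp
    | succ n ih =>
      calc x (n + 1) ≤ q * x n := hstep n
        _ ≤ q * (q ^ n * x 0) := by gcongr
        _ = q ^ (n + 1) * x 0 := by ring
  have hlim : Tendsto x atTop (𝓝 0) := by
    refine squeeze_zero hx0 hgeo ?_
    simpa using (tendsto_pow_atTop_nhds_zero_of_lt_one hq0 hq1).mul_const (x 0)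
  have := (continuous_coe_real_ereal.tendsto 0).comp hlim
  refine this.congr fun n => ?_
  simp only [Function.comp, hx, hreal]

end Cone

/-! ### Perturbations of the identity of the line -/

section Shift

/-- The inverse of the map `t ↦ t + h t`. -/
noncomputable def invShift (h : ℝ → ℝ) : ℝ → ℝ := Function.invFun fun t => t + h t

/-- `h` is `C^1` with derivative `h₁`, `1`-periodic, and `|h₁| ≤ 1 / 10`. -/
structure SmallShift (h h₁ : ℝ → ℝ) : Prop where
  hasDerivAt : ∀ t, HasDerivAt h (h₁ t) t
  continuous_deriv : Continuous h₁
  periodic : ∀ t, h (t + 1) = h t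
  bound : ∀ t, |h₁ t| ≤ 1 / 10

namespace SmallShift

variable {h h₁ : ℝ → ℝ} (S : SmallShift h h₁)
include S

theorem continuous : Continuous h :=
  continuous_iff_continuousAt.2 fun t => (S.hasDerivAt t).continuousAt

theorem periodic_deriv (t : ℝ) : h₁ (t + 1) = h₁ t := by
  have h1 : HasDerivAt (fun s => h (s + 1)) (h₁ (t + 1)) t :=
    (S.hasDerivAt (t + 1)).comp_add_const t 1
  simp only [S.periodic] at h1
  exact h1.unique (S.hasDerivAt t)

theorem le_one_add (t : ℝ) : 9 / 10 ≤ 1 + h₁ t := by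
  have := (abs_le.1 (S.bound t)).1
  linarith

theorem one_add_pos (t : ℝ) : 0 < 1 + h₁ t := by linarith [S.le_one_add t]

theorem one_add_le (t : ℝ) : 1 + h₁ t ≤ 11 / 10 := by
  have := (abs_le.1 (S.bound t)).2
  linarith

theorem abs_sub_le (s t : ℝ) : |h s - h t| ≤ 1 / 10 * |s - t| := by
  have := Convex.norm_image_sub_le_of_norm_hasDerivWithin_le (f := h) (f' := h₁) (C := 1 / 10)
    (s := univ) (x := t) (y := s) (fun x _ => (S.hasDerivAt x).hasDerivWithinAt)
    (fun x _ => S.bound x) convex_univ (mem_univ _) (mem_univ _)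
  simpa using this

/-- This one estimate yields injectivity, the Lipschitz bound for the inverse, and stability of the
inverse under a change of `h`. -/
theorem expansion (s t : ℝ) : 9 / 10 * |s - t| ≤ |(s + h s) - (t + h t)| := by
  have h1 := S.abs_sub_le s t
  have h2 : |s - t| ≤ |(s + h s) - (t + h t)| + |h s - h t| := by
    have : s - t = ((s + h s) - (t + h t)) - (h s - h t) := by ring
    rw [this]
    exact (abs_sub _ _)
  linarith

theorem injective : Function.Injective fun t => t + h t := by
  intro s t hst
  have := S.expansion s t
  simp only at hst
  rw [hst, sub_self, abs_zero] at this
  have h2 := abs_nonneg (s - t)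
  exact sub_eq_zero.1 (abs_eq_zero.1 (by linarith))

theorem surjective : Function.Surjective fun t => t + h t := by
  have hc : Continuous fun t => t + h t := continuous_id.add S.continuous
  have hb : ∀ t, |h t - h 0| ≤ 1 / 10 * |t| := fun t => by simpa using S.abs_sub_le t 0
  refine hc.surjective ?_ ?_
  · refine tendsto_atTop_mono' atTop (f₁ := fun t => 9 / 10 * t + h 0) ?_ ?_
    · filter_upwards [eventually_ge_atTop 0] with t ht
      have := (abs_le.1 (hb t)).1
      rw [abs_of_nonneg ht] at this
      linarith
    · exact tendsto_atTop_add_const_right _ _ (tendsto_id.const_mul_atTop (by norm_num))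
  · refine tendsto_atBot_mono' atBot (f₁ := fun t => 9 / 10 * t + h 0) ?_ ?_
    · filter_upwards [eventually_le_atBot 0] with t ht
      have := (abs_le.1 (hb t)).2
      rw [abs_of_nonpos ht] at this
      linarith
    · exact tendsto_atBot_add_const_right _ _ (tendsto_id.const_mul_atBot (by norm_num))

theorem apply_invShift (x : ℝ) : invShift h x + h (invShift h x) = x :=
  Function.rightInverse_invFun S.surjective x

theorem invShift_apply (t : ℝ) : invShift h (t + h t) = t :=
  Function.leftInverse_invFun S.injective t

theorem invShift_add_one (x : ℝ) : invShift h (x + 1) = invShift h x + 1 := by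
  apply S.injective
  simp only
  rw [S.apply_invShift, S.periodic]
  linarith [S.apply_invShift x]

theorem abs_invShift_sub_le (x y : ℝ) : |invShift h x - invShift h y| ≤ 10 / 9 * |x - y| := by
  have := S.expansion (invShift h x) (invShift h y)
  rw [S.apply_invShift, S.apply_invShift] at this
  linarith

theorem continuous_invShift : Continuous (invShift h) := by
  have : LipschitzWith (10 / 9) (invShift h) := by
    refine LipschitzWith.of_dist_le_mul fun x y => ?_
    simpa [Real.dist_eq] using S.abs_invShift_sub_le x y
  exact this.continuous

theorem hasDerivAt_invShift (x : ℝ) :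
    HasDerivAt (invShift h) (1 + h₁ (invShift h x))⁻¹ x := by
  refine HasDerivAt.of_local_left_inverse (f := fun t => t + h t)
    S.continuous_invShift.continuousAt ((hasDerivAt_id _).add (S.hasDerivAt _))
    (S.one_add_pos _).ne' (Eventually.of_forall S.apply_invShift)

/-- Two perturbations of the identity have inverses as close as the perturbations are. -/
theorem abs_invShift_sub_invShift_le {l l₁ : ℝ → ℝ} (S' : SmallShift l l₁) {C : ℝ}
    (hC : ∀ t, |h t - l t| ≤ C) (x : ℝ) : |invShift h x - invShift l x| ≤ 10 / 9 * C := by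
  have h1 := S.expansion (invShift h x) (invShift l x)
  have h2 := S.apply_invShift x
  have h3 := S'.apply_invShift x
  have h4 := hC (invShift l x)
  have : (invShift h x + h (invShift h x)) - (invShift l x + h (invShift l x))
      = - (h (invShift l x) - l (invShift l x)) := by linarith
  rw [this, abs_neg] at h1
  linarith

end SmallShift

/-- The density `p / (1 + h')`, before composition with the inverse of `t ↦ t + h t`. -/
noncomputable def shiftDensity (p h₁ : ℝ → ℝ) (t : ℝ) : ℝ := p t / (1 + h₁ t)

/-- The derivative of the image density, before composition with the inverse map. -/
noncomputable def shiftDeriv (p p₁ h₁ h₂ : ℝ → ℝ) (t : ℝ) : ℝ :=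
  p₁ t / (1 + h₁ t) ^ 2 - p t * h₂ t / (1 + h₁ t) ^ 3

/-- The second derivative of the image density, before composition with the inverse map. -/
noncomputable def shiftDeriv₂ (p p₁ p₂ h₁ h₂ h₃ : ℝ → ℝ) (t : ℝ) : ℝ :=
  p₂ t / (1 + h₁ t) ^ 3 - 3 * (p₁ t * h₂ t) / (1 + h₁ t) ^ 4 - p t * h₃ t / (1 + h₁ t) ^ 4
    + 3 * (p t * h₂ t ^ 2) / (1 + h₁ t) ^ 5

theorem hasDerivAt_shiftDensity {p p₁ h₁ h₂ : ℝ → ℝ} {t : ℝ} (hp : HasDerivAt p (p₁ t) t)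
    (hh : HasDerivAt h₁ (h₂ t) t) (h0 : 1 + h₁ t ≠ 0) :
    HasDerivAt (shiftDensity p h₁) (shiftDeriv p p₁ h₁ h₂ t * (1 + h₁ t)) t := by
  refine HasDerivAt.congr_deriv (f := shiftDensity p h₁) (hp.div (hh.const_add 1) h0) ?_
  unfold shiftDeriv
  field_simp

theorem hasDerivAt_shiftDeriv {p p₁ p₂ h₁ h₂ h₃ : ℝ → ℝ} {t : ℝ} (hp : HasDerivAt p (p₁ t) t)
    (hp₁ : HasDerivAt p₁ (p₂ t) t) (hh : HasDerivAt h₁ (h₂ t) t) (hh₂ : HasDerivAt h₂ (h₃ t) t)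
    (h0 : 1 + h₁ t ≠ 0) :
    HasDerivAt (shiftDeriv p p₁ h₁ h₂) (shiftDeriv₂ p p₁ p₂ h₁ h₂ h₃ t * (1 + h₁ t)) t := by
  refine HasDerivAt.congr_deriv (f := shiftDeriv p p₁ h₁ h₂)
    ((hp₁.div ((hh.const_add 1).pow 2) (pow_ne_zero 2 h0)).sub
      ((hp.mul hh₂).div ((hh.const_add 1).pow 3) (pow_ne_zero 3 h0))) ?_
  unfold shiftDeriv₂
  simp only [Pi.pow_apply, Pi.mul_apply]
  field_simp
  ring

/-- Writing derivatives as `v * (1 + h₁)` lets the chain-rule factor of the inverse cancel, so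
densities are differentiated before composition. -/
theorem SmallShift.hasDerivAt_comp_invShift {h h₁ u v : ℝ → ℝ} (S : SmallShift h h₁)
    (hu : ∀ t, HasDerivAt u (v t * (1 + h₁ t)) t) (x : ℝ) :
    HasDerivAt (fun x => u (invShift h x)) (v (invShift h x)) x := by
  have := (hu (invShift h x)).comp x (S.hasDerivAt_invShift x)
  rwa [mul_assoc, mul_inv_cancel₀ (S.one_add_pos _).ne', mul_one] at this

end Shift

/-! ### Averaging over the inverse branches of `x ↦ k x mod 1` -/

section Branch

/-- The transfer operator of `x ↦ k x mod 1` on periodic functions of the line. -/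
noncomputable def branchAvg (k : ℕ) (u : ℝ → ℝ) (x : ℝ) : ℝ :=
  (∑ j ∈ Finset.range k, u ((x + j) / k)) / k

variable {k : ℕ} {u v : ℝ → ℝ}

/-- The factor `1 / k` is the whole regularising effect of the expanding map. -/
theorem hasDerivAt_branchAvg (hu : ∀ t, HasDerivAt u (v t) t) (x : ℝ) :
    HasDerivAt (branchAvg k u) (branchAvg k v x / k) x := by
  have h1 : HasDerivAt (fun x : ℝ => ∑ j ∈ Finset.range k, u ((x + j) / k))
      (∑ j ∈ Finset.range k, v ((x + j) / k) * (1 / k)) x := by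
    refine HasDerivAt.fun_sum fun j _ => ?_
    exact (hu ((x + j) / k)).comp x (((hasDerivAt_id x).add_const (j : ℝ)).div_const (k : ℝ))
  refine HasDerivAt.congr_deriv (f := branchAvg k u) (h1.div_const (k : ℝ)) ?_
  rw [branchAvg, ← Finset.sum_mul]
  ring

theorem continuous_branchAvg (hu : Continuous u) : Continuous (branchAvg k u) := by
  unfold branchAvg
  fun_prop

/-- Translation by `1` permutes the inverse branches cyclically, the last returning to the first by
periodicity of `u`. -/
theorem branchAvg_add_one (hk : 0 < k) (hu : ∀ t, u (t + 1) = u t) (x : ℝ) :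
    branchAvg k u (x + 1) = branchAvg k u x := by
  have hk' : (k : ℝ) ≠ 0 := by positivity
  unfold branchAvg
  congr 1
  have h1 := Finset.sum_range_succ (fun j : ℕ => u ((x + j) / k)) k
  have h2 := Finset.sum_range_succ' (fun j : ℕ => u ((x + j) / k)) k
  have h3 : u ((x + (k : ℕ)) / k) = u ((x + (0 : ℕ)) / k) := by
    rw [add_div, div_self hk', hu]
    simp
  have h4 : ∑ j ∈ Finset.range k, u ((x + 1 + j) / k)
      = ∑ j ∈ Finset.range k, u ((x + ((j + 1 : ℕ) : ℝ)) / k) := by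
    refine Finset.sum_congr rfl fun j _ => ?_
    push_cast
    ring_nf
  rw [h4]
  linarith

theorem le_branchAvg (hk : 0 < k) {c : ℝ} (hu : ∀ t, c ≤ u t) (x : ℝ) : c ≤ branchAvg k u x := by
  have hk' : (0 : ℝ) < k := by positivity
  rw [branchAvg, le_div_iff₀ hk']
  calc c * k = ∑ _j ∈ Finset.range k, c := by simp [mul_comm]
    _ ≤ _ := Finset.sum_le_sum fun j _ => hu _

theorem branchAvg_sub_mul (u v : ℝ → ℝ) (c x : ℝ) :
    branchAvg k (fun t => u t - c * v t) x = branchAvg k u x - c * branchAvg k v x := by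
  simp only [branchAvg, Finset.sum_sub_distrib, ← Finset.mul_sum]
  ring

theorem abs_branchAvg_le (hk : 0 < k) {c : ℝ} (hu : ∀ t, |u t| ≤ c) (x : ℝ) :
    |branchAvg k u x| ≤ c := by
  have hk' : (0 : ℝ) < k := by positivity
  rw [branchAvg, abs_div, abs_of_pos hk', div_le_iff₀ hk']
  calc _ ≤ ∑ j ∈ Finset.range k, |u ((x + j) / k)| := Finset.abs_sum_le_sum_abs _ _
    _ ≤ ∑ _j ∈ Finset.range k, c := Finset.sum_le_sum fun j _ => hu _
    _ = c * k := by simp [mul_comm]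

/-- Duality with composition by `x ↦ k x`: rescale to `[0, k]`, cut into unit intervals, and use
periodicity of `F`. -/
theorem integral_mul_branchAvg (hk : 0 < k) {F G : ℝ → ℝ} (hF : Continuous F) (hG : Continuous G)
    (hFp : ∀ t, F (t + 1) = F t) :
    ∫ x in (0 : ℝ)..1, F x * branchAvg k G x = ∫ s in (0 : ℝ)..1, F (k * s) * G s := by
  have hk' : (k : ℝ) ≠ 0 := by positivity
  have hFn : ∀ (n : ℕ) t, F (t + n) = F t := fun n t => by
    induction n with
    | zero => simp
    | succ n ih => rw [Nat.cast_succ, ← add_assoc, hFp, ih]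
  have h1 : ∫ s in (0 : ℝ)..1, F (k * s) * G s
      = (k : ℝ)⁻¹ * ∫ x in (0 : ℝ)..k, F x * G (x / k) := by
    have := intervalIntegral.integral_comp_mul_left (a := 0) (b := 1)
      (fun x => F x * G (x / k)) hk'
    simp only [mul_div_cancel_left₀ _ hk', mul_zero, mul_one, smul_eq_mul] at this
    exact this
  have hc : Continuous fun x => F x * G (x / k) := by fun_prop
  have h2 : ∫ x in (0 : ℝ)..k, F x * G (x / k)
      = ∑ j ∈ Finset.range k, ∫ x in (0 : ℝ)..1, F x * G ((x + j) / k) := by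
    have := intervalIntegral.sum_integral_adjacent_intervals (f := fun x => F x * G (x / k))
      (a := fun n : ℕ => (n : ℝ)) (n := k) (μ := volume)
      fun j _ => hc.intervalIntegrable _ _
    rw [Nat.cast_zero] at this
    rw [← this]
    refine Finset.sum_congr rfl fun j _ => ?_
    have h3 := intervalIntegral.integral_comp_add_right (a := 0) (b := 1)
      (fun x => F x * G (x / k)) (j : ℝ)
    rw [zero_add, add_comm (1 : ℝ)] at h3
    rw [Nat.cast_succ, ← h3]
    simp only [hFn]
  rw [h1, h2, ← intervalIntegral.integral_finsetSum]
  · rw [← intervalIntegral.integral_const_mul]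
    refine intervalIntegral.integral_congr fun x _ => ?_
    simp only [branchAvg, ← Finset.mul_sum]
    ring
  · intro j _
    exact (by fun_prop : Continuous fun x => F x * G ((x + j) / k)).intervalIntegrable _ _

theorem SmallShift.integral_comp_shift {h h₁ : ℝ → ℝ} (S : SmallShift h h₁) {F p : ℝ → ℝ}
    (hF : Continuous F) (hp : Continuous p) (hFp : ∀ t, F (t + 1) = F t)
    (hpp : ∀ t, p (t + 1) = p t) :
    ∫ t in (0 : ℝ)..1, F (t + h t) * p t
      = ∫ s in (0 : ℝ)..1, F s * shiftDensity p h₁ (invShift h s) := by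
  have hsh : Continuous (shiftDensity p h₁) :=
    hp.div (continuous_const.add S.continuous_deriv) fun t => (S.one_add_pos t).ne'
  have hQ : Continuous fun s => F s * shiftDensity p h₁ (invShift h s) :=
    hF.mul (hsh.comp S.continuous_invShift)
  have h1 := intervalIntegral.integral_comp_mul_deriv (a := 0) (b := 1)
    (f := fun t => t + h t) (f' := fun t => 1 + h₁ t)
    (g := fun s => F s * shiftDensity p h₁ (invShift h s))
    (fun t _ => (hasDerivAt_id t).add (S.hasDerivAt t))
    (continuous_const.add S.continuous_deriv).continuousOn hQ
  have hper : Function.Periodic (fun s => F s * shiftDensity p h₁ (invShift h s)) 1 := by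
    intro s
    simp only [hFp, S.invShift_add_one, shiftDensity, hpp, S.periodic_deriv]
  -- The substitution lands on `[h 0, h 0 + 1]`, a full period, which may be slid back to `[0, 1]`.
  have h2 := hper.intervalIntegral_add_eq (h 0) 0
  have h3 : h 1 = h 0 := by simpa using S.periodic 0
  rw [zero_add, h3, add_comm (1 : ℝ), h2, zero_add] at h1
  rw [← h1]
  refine intervalIntegral.integral_congr fun t _ => ?_
  simp only [Function.comp, S.invShift_apply, shiftDensity]
  have := (S.one_add_pos t).ne'
  field_simp

end Branch

/-! ### Interaction kernels on the plane -/

section Kernel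

/-- A kernel `K 0` on the plane, periodic in the first variable, with its first three partial
derivatives `K i` in the first variable, bounded by `N`, of mean zero in the second variable. -/
structure KernelBounds (K : ℕ → ℝ → ℝ → ℝ) (N Θ : ℝ) : Prop where
  cont : ∀ i, i ≤ 3 → Continuous (Function.uncurry (K i))
  hasDerivAt : ∀ i, i < 3 → ∀ t y, HasDerivAt (fun s => K i s y) (K (i + 1) t y) t
  periodic : ∀ t y, K 0 (t + 1) y = K 0 t y
  mean_zero : ∀ i, i ≤ 3 → ∀ t, ∫ y in (0 : ℝ)..1, K i t y = 0
  bound : ∀ i, i ≤ 3 → ∀ t y, |K i t y| ≤ N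
  l1_bound : ∀ t, ∫ y in (0 : ℝ)..1, |K 2 t y| ≤ Θ

/-- The mean field generated by the density `p` through the kernel `K`. -/
noncomputable def meanField (K : ℝ → ℝ → ℝ) (p : ℝ → ℝ) (t : ℝ) : ℝ :=
  (∫ y in (0 : ℝ)..1, K t y * p y) / ∫ y in (0 : ℝ)..1, p y

namespace KernelBounds

variable {K : ℕ → ℝ → ℝ → ℝ} {N Θ : ℝ} (hK : KernelBounds K N Θ) {p q : ℝ → ℝ}
include hK

theorem nonneg : 0 ≤ N := (abs_nonneg _).trans (hK.bound 0 (by norm_num) 0 0)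

theorem continuous_right {i : ℕ} (hi : i ≤ 3) (t : ℝ) : Continuous (K i t) :=
  (hK.cont i hi).comp (Continuous.prodMk_right t)

theorem l1_nonneg : 0 ≤ Θ :=
  (intervalIntegral.integral_nonneg (by norm_num) fun y _ => abs_nonneg (K 2 0 y)).trans
    (hK.l1_bound 0)

theorem continuous_meanField {i : ℕ} (hi : i ≤ 3) (hp : Continuous p) :
    Continuous (meanField (K i) p) := by
  unfold meanField
  refine Continuous.div_const ?_ _
  refine intervalIntegral.continuous_parametric_intervalIntegral_of_continuous' ?_ 0 1
  exact (hK.cont i hi).mul (hp.comp continuous_snd)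

theorem hasDerivAt_meanField {i : ℕ} (hi : i < 3) (hp : Continuous p) (t : ℝ) :
    HasDerivAt (meanField (K i) p) (meanField (K (i + 1)) p t) t := by
  have hc : ∀ j, j ≤ 3 → ∀ s, Continuous fun y => K j s y * p y := fun j hj s =>
    (hK.continuous_right hj s).mul hp
  have := (intervalIntegral.hasDerivAt_integral_of_dominated_loc_of_deriv_le (𝕜 := ℝ)
    (μ := volume) (a := 0) (b := 1) (F := fun s y => K i s y * p y)
    (F' := fun s y => K (i + 1) s y * p y) (x₀ := t) (s := univ)
    (bound := fun y => N * |p y|) Filter.univ_mem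
    (Eventually.of_forall fun s => (hc i hi.le s).aestronglyMeasurable)
    ((hc i hi.le t).intervalIntegrable _ _) (hc (i + 1) hi t).aestronglyMeasurable
    (Eventually.of_forall fun y _ s _ => ?_)
    ((continuous_const.mul hp.abs).intervalIntegrable _ _)
    (Eventually.of_forall fun y _ s _ => (hK.hasDerivAt i hi s y).mul_const _)).2
  · exact this.div_const _
  · rw [Real.norm_eq_abs, abs_mul]
    exact mul_le_mul_of_nonneg_right (hK.bound (i + 1) hi s y) (abs_nonneg _)

theorem meanField_periodic (p : ℝ → ℝ) (t : ℝ) :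
    meanField (K 0) p (t + 1) = meanField (K 0) p t := by
  simp only [meanField, hK.periodic]

/-- Mean zero lets any constant be subtracted from the density, so the field depends only on its
oscillation. -/
theorem integral_mul_eq {i : ℕ} (hi : i ≤ 3) (hq : Continuous q) (c t : ℝ) :
    ∫ y in (0 : ℝ)..1, K i t y * q y = ∫ y in (0 : ℝ)..1, K i t y * (q y - c) := by
  have h1 : ∀ y, K i t y * (q y - c) = K i t y * q y - K i t y * c := fun y => mul_sub _ _ _
  simp only [h1]
  rw [intervalIntegral.integral_sub, intervalIntegral.integral_mul_const, hK.mean_zero i hi]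
  · simp
  · exact ((hK.continuous_right hi t).mul hq).intervalIntegrable _ _
  · exact ((hK.continuous_right hi t).mul continuous_const).intervalIntegrable _ _

/-- The `L¹` form keeps the sharp constant; it is reserved for the one leading-order field term. -/
theorem abs_integral_mul_le_l1 {i : ℕ} (hi : i ≤ 3) (hq : Continuous q) {c d : ℝ}
    (h : ∀ y, |q y - c| ≤ d) (t : ℝ) :
    |∫ y in (0 : ℝ)..1, K i t y * q y| ≤ (∫ y in (0 : ℝ)..1, |K i t y|) * d := by
  rw [hK.integral_mul_eq hi hq c, ← intervalIntegral.integral_mul_const]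
  refine (intervalIntegral.abs_integral_le_integral_abs (by norm_num)).trans ?_
  have hcK := hK.continuous_right hi t
  refine intervalIntegral.integral_mono_on (by norm_num) ?_ ?_ fun y _ => ?_
  · exact (hcK.mul (hq.sub continuous_const)).abs.intervalIntegrable _ _
  · exact (hcK.abs.mul continuous_const).intervalIntegrable _ _
  · rw [abs_mul]
    exact mul_le_mul_of_nonneg_left (h y) (abs_nonneg _)

theorem abs_integral_mul_le {i : ℕ} (hi : i ≤ 3) (hq : Continuous q) {c d : ℝ}
    (h : ∀ y, |q y - c| ≤ d) (t : ℝ) :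
    |∫ y in (0 : ℝ)..1, K i t y * q y| ≤ N * d := by
  refine (hK.abs_integral_mul_le_l1 hi hq h t).trans ?_
  refine mul_le_mul_of_nonneg_right ?_ ((abs_nonneg _).trans (h 0))
  have hcK := hK.continuous_right hi t
  refine (intervalIntegral.integral_mono_on (g := fun _ => N) (by norm_num)
    (hcK.abs.intervalIntegrable _ _) (by simp) fun y _ => hK.bound i hi t y).trans ?_
  simp

end KernelBounds

/-- The partial derivative in the first variable. -/
noncomputable def partialFst (F : ℝ × ℝ → ℝ) (p : ℝ × ℝ) : ℝ := fderiv ℝ F p (1, 0)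

theorem hasDerivAt_partialFst {F : ℝ × ℝ → ℝ} (hF : Differentiable ℝ F) (t y : ℝ) :
    HasDerivAt (fun s => F (s, y)) (partialFst F (t, y)) t := by
  have h1 : HasDerivAt (fun s : ℝ => (s, y)) ((1 : ℝ), (0 : ℝ)) t :=
    (hasDerivAt_id t).prodMk (hasDerivAt_const t y)
  exact (hF (t, y)).hasFDerivAt.comp_hasDerivAt t h1

theorem contDiff_partialFst {F : ℝ × ℝ → ℝ} {m n : WithTop ℕ∞} (hF : ContDiff ℝ n F)
    (h : m + 1 ≤ n) : ContDiff ℝ m (partialFst F) :=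
  (hF.fderiv_right h).clm_apply contDiff_const

theorem partialFst_add {F : ℝ × ℝ → ℝ} {v : ℝ × ℝ} (hF : ∀ p, F (p + v) = F p) (p : ℝ × ℝ) :
    partialFst F (p + v) = partialFst F p := by
  unfold partialFst
  rw [← fderiv_comp_add_right]
  simp only [hF]

theorem contDiff_iterate_partialFst {F : ℝ × ℝ → ℝ} (i : ℕ) :
    ∀ {n : ℕ}, ContDiff ℝ ((n + i : ℕ) : WithTop ℕ∞) F → ContDiff ℝ n (partialFst^[i] F) := by
  induction i generalizing F with
  | zero => intro n h; simpa using h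
  | succ i ih =>
    intro n h
    rw [Function.iterate_succ_apply]
    refine ih (contDiff_partialFst h ?_)
    exact_mod_cast le_rfl

theorem iterate_partialFst_add {F : ℝ × ℝ → ℝ} {v : ℝ × ℝ} (hF : ∀ p, F (p + v) = F p) (i : ℕ)
    (p : ℝ × ℝ) : partialFst^[i] F (p + v) = partialFst^[i] F p := by
  induction i generalizing p with
  | zero => exact hF p
  | succ i ih =>
    rw [Function.iterate_succ_apply']
    exact partialFst_add ih p

theorem exists_bound_of_doubly_periodic {F : ℝ × ℝ → ℝ} (hF : Continuous F)
    (h1 : ∀ p, F (p + (1, 0)) = F p) (h2 : ∀ p, F (p + (0, 1)) = F p) :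
    ∃ C, ∀ p, |F p| ≤ C := by
  obtain ⟨C, hC⟩ := (isCompact_Icc.prod isCompact_Icc :
    IsCompact (Icc (0 : ℝ) 1 ×ˢ Icc (0 : ℝ) 1)).exists_bound_of_continuousOn hF.continuousOn
  refine ⟨C, fun ⟨x, y⟩ => ?_⟩
  have hx : F (x, y) = F (Int.fract x, y) := by
    have : Function.Periodic (fun s => F (s, y)) 1 := fun s => by simpa using h1 (s, y)
    have := this.sub_int_mul_eq (x := x) ⌊x⌋
    rw [mul_one] at this
    exact this.symm
  have hy : F (Int.fract x, y) = F (Int.fract x, Int.fract y) := by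
    have : Function.Periodic (fun s => F (Int.fract x, s)) 1 := fun s => by
      simpa using h2 (Int.fract x, s)
    have := this.sub_int_mul_eq (x := y) ⌊y⌋
    rw [mul_one] at this
    exact this.symm
  rw [hx, hy]
  exact hC _ ⟨⟨Int.fract_nonneg _, (Int.fract_lt_one _).le⟩,
    ⟨Int.fract_nonneg _, (Int.fract_lt_one _).le⟩⟩

/-- The lift to the plane of `δ ∂₁^i H`. -/
noncomputable def torusKernel (H : UnitAddCircle → UnitAddCircle → ℝ) (δ : ℝ) (i : ℕ)
    (t y : ℝ) : ℝ :=
  δ * partialFst^[i] (fun p : ℝ × ℝ => H (p.1 : UnitAddCircle) (p.2 : UnitAddCircle)) (t, y)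

theorem iteratedDeriv_two_eq {u u₁ u₂ : ℝ → ℝ} (h : ∀ t, HasDerivAt u (u₁ t) t)
    (h₁ : ∀ t, HasDerivAt u₁ (u₂ t) t) : iteratedDeriv 2 u = u₂ := by
  rw [iteratedDeriv_succ, iteratedDeriv_one, show deriv u = u₁ from funext fun t => (h t).deriv]
  exact funext fun t => (h₁ t).deriv

theorem circleDeriv_two_coe {φ : UnitAddCircle → ℝ} {u u₁ u₂ : ℝ → ℝ}
    (hφ : ∀ t : ℝ, φ t = u t) (h : ∀ t, HasDerivAt u (u₁ t) t)
    (h₁ : ∀ t, HasDerivAt u₁ (u₂ t) t) (s : ℝ) : circleDeriv 2 φ (s : UnitAddCircle) = u₂ s := by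
  unfold circleDeriv
  have e : (fun t : ℝ => φ ((s : UnitAddCircle) + (t : UnitAddCircle))) = fun t => u (s + t) := by
    funext t
    rw [← AddCircle.coe_add, hφ]
  rw [e, iteratedDeriv_two_eq (u₁ := fun t => u₁ (s + t)) (u₂ := fun t => u₂ (s + t))
    (fun t => (h (s + t)).comp_const_add s t) (fun t => (h₁ (s + t)).comp_const_add s t)]
  simp

theorem integral_circle_eq (f : UnitAddCircle → ℝ) :
    ∫ x : UnitAddCircle, f x = ∫ t in (0 : ℝ)..1, f (t : UnitAddCircle) := by
  rw [← UnitAddCircle.intervalIntegral_preimage 0, zero_add]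

/-- `δ` is absorbed into the kernel. `N` is a crude compactness bound entering only error terms,
while `Θ` is the constant of the hypothesis. -/
theorem exists_kernelBounds {H : UnitAddCircle → UnitAddCircle → ℝ} (hH : TorusContDiff 3 H)
    (hmean : ∀ x : UnitAddCircle, ∫ y : UnitAddCircle, H x y = 0) (δ : ℝ) :
    ∃ N, KernelBounds (torusKernel H δ) N (|δ| * ⨆ x : UnitAddCircle, partialNorm H 2 x) := by
  set F : ℝ × ℝ → ℝ := fun p => H (p.1 : UnitAddCircle) (p.2 : UnitAddCircle) with hFdef
  have hF : ContDiff ℝ (3 : ℕ) F := hH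
  have hp1 : ∀ p, F (p + (1, 0)) = F p := fun p => by simp [hFdef]
  have hp2 : ∀ p, F (p + (0, 1)) = F p := fun p => by simp [hFdef]
  have hC : ∀ i, i ≤ 3 → ContDiff ℝ ((3 - i : ℕ) : WithTop ℕ∞) (partialFst^[i] F) := fun i hi =>
    contDiff_iterate_partialFst i (by rw [Nat.sub_add_cancel hi]; exact hF)
  have hder : ∀ i, i < 3 → ∀ t y, HasDerivAt (fun s => partialFst^[i] F (s, y))
      (partialFst^[i + 1] F (t, y)) t := fun i hi t y => by
    rw [Function.iterate_succ_apply']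
    refine hasDerivAt_partialFst ((hC i hi.le).differentiable ?_) t y
    have : 3 - i ≠ 0 := by omega
    exact_mod_cast this
  choose! C hCb using fun i (hi : i ≤ 3) => exists_bound_of_doubly_periodic (hC i hi).continuous
    (iterate_partialFst_add hp1 i) (iterate_partialFst_add hp2 i)
  obtain ⟨N, hN⟩ : ∃ N, ∀ i, i ≤ 3 → |δ| * C i ≤ N := by
    refine ⟨∑ i ∈ Finset.range 4, |(|δ| * C i)|, fun i hi => ?_⟩
    exact (le_abs_self _).trans (Finset.single_le_sum (f := fun i => |(|δ| * C i)|)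
      (fun _ _ => abs_nonneg _) (Finset.mem_range.2 (by omega)))
  have hbound : ∀ i, i ≤ 3 → ∀ t y, |torusKernel H δ i t y| ≤ N := fun i hi t y => by
    rw [torusKernel, abs_mul]
    exact (mul_le_mul_of_nonneg_left (hCb i hi (t, y)) (abs_nonneg _)).trans (hN i hi)
  have hcont : ∀ i, i ≤ 3 → Continuous (Function.uncurry (torusKernel H δ i)) := fun i hi =>
    continuous_const.mul (hC i hi).continuous
  have hderK : ∀ i, i < 3 → ∀ t y, HasDerivAt (fun s => torusKernel H δ i s y)
      (torusKernel H δ (i + 1) t y) t := fun i hi t y => (hder i hi t y).const_mul δ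
  have hL : ∀ t : ℝ, partialNorm H 2 (t : UnitAddCircle)
      = ∫ y in (0 : ℝ)..1, |partialFst^[2] F (t, y)| := fun t => by
    rw [partialNorm, integral_circle_eq]
    refine intervalIntegral.integral_congr fun y _ => ?_
    rw [circleDeriv_two_coe (u := fun s => F (s, y)) (fun s => rfl)
      (hder 0 (by norm_num) · y) (hder 1 (by norm_num) · y)]
  have hbdd : BddAbove (range fun x : UnitAddCircle => partialNorm H 2 x) := by
    refine ⟨C 2, ?_⟩
    rintro _ ⟨x, rfl⟩
    induction x using QuotientAddGroup.induction_on with | _ t => ?_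
    refine (hL t).trans_le ?_
    have hc2 : Continuous fun y : ℝ => |partialFst^[2] F (t, y)| :=
      ((hC 2 (by norm_num)).continuous.comp (Continuous.prodMk_right t)).abs
    refine (intervalIntegral.integral_mono_on (g := fun _ => C 2) (by norm_num)
      (hc2.intervalIntegrable _ _) (by simp) fun y _ => hCb 2 (by norm_num) (t, y)).trans ?_
    simp
  refine ⟨N, hcont, hderK, fun t y => ?_, ?_, hbound, fun t => ?_⟩
  · have := hp1 (t, y)
    rw [Prod.mk_add_mk, add_zero] at this
    exact congrArg (δ * ·) this
  · intro i
    induction i with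
    | zero =>
      intro _ t
      have := hmean (t : UnitAddCircle)
      rw [integral_circle_eq] at this
      simp only [torusKernel, Function.iterate_zero, id]
      rw [intervalIntegral.integral_const_mul, this, mul_zero]
    | succ i ih =>
      intro hi t
      have hi' : i < 3 := by omega
      have hz : ∀ s, ∫ y in (0 : ℝ)..1, torusKernel H δ i s y = 0 := ih hi'.le
      have hcr : ∀ j, j ≤ 3 → ∀ s, Continuous (torusKernel H δ j s) := fun j hj s =>
        (hcont j hj).comp (Continuous.prodMk_right s)
      have := (intervalIntegral.hasDerivAt_integral_of_dominated_loc_of_deriv_le (𝕜 := ℝ)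
        (μ := volume) (a := 0) (b := 1) (F := fun s y => torusKernel H δ i s y)
        (F' := fun s y => torusKernel H δ (i + 1) s y) (x₀ := t) (s := univ)
        (bound := fun _ => N) Filter.univ_mem
        (Eventually.of_forall fun s => (hcr i hi'.le s).aestronglyMeasurable)
        ((hcr i hi'.le t).intervalIntegrable _ _) (hcr (i + 1) hi t).aestronglyMeasurable
        (Eventually.of_forall fun y _ s _ => hbound (i + 1) hi s y)
        (by simp)
        (Eventually.of_forall fun y _ s _ => hderK i hi' s y)).2
      -- The integral vanishes for every `s`, so its derivative, the integral of the next partial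
      -- derivative, vanishes too.
      simp only [hz] at this
      exact this.unique (hasDerivAt_const t 0)
  · simp only [torusKernel, abs_mul]
    rw [intervalIntegral.integral_const_mul, ← hFdef, ← hL]
    exact mul_le_mul_of_nonneg_left (le_ciSup hbdd _) (abs_nonneg _)

end Kernel

/-! ### Periodic functions with bounded logarithmic derivative -/

section Harnack

theorem le_exp_mul_of_abs_deriv_le {q q₁ : ℝ → ℝ} {a : ℝ} (hd : ∀ t, HasDerivAt q (q₁ t) t)
    (hpos : ∀ t, 0 < q t) (hb : ∀ t, |q₁ t| ≤ a * q t) (s t : ℝ) :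
    q s ≤ Real.exp (a * |s - t|) * q t := by
  have h1 : ∀ x, HasDerivAt (fun t => Real.log (q t)) (q₁ x / q x) x := fun x =>
    (hd x).log (hpos x).ne'
  have := Convex.norm_image_sub_le_of_norm_hasDerivWithin_le (f := fun t => Real.log (q t))
    (f' := fun x => q₁ x / q x) (C := a)
    (s := univ) (x := t) (y := s) (fun x _ => (h1 x).hasDerivWithinAt)
    (fun x _ => by
      rw [Real.norm_eq_abs, abs_div, abs_of_pos (hpos x), div_le_iff₀ (hpos x)]
      exact hb x) convex_univ (mem_univ _) (mem_univ _)
  rw [Real.norm_eq_abs, Real.norm_eq_abs] at this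
  have h2 := (abs_le.1 this).2
  rw [← Real.log_le_log_iff (hpos s) (mul_pos (Real.exp_pos _) (hpos t)),
    Real.log_mul (Real.exp_pos _).ne' (hpos t).ne', Real.log_exp]
  linarith

theorem le_exp_half_mul {q q₁ : ℝ → ℝ} {a : ℝ} (ha : 0 ≤ a) (hd : ∀ t, HasDerivAt q (q₁ t) t)
    (hper : ∀ t, q (t + 1) = q t) (hpos : ∀ t, 0 < q t) (hb : ∀ t, |q₁ t| ≤ a * q t) (s t : ℝ) :
    q s ≤ Real.exp (a / 2) * q t := by
  -- An integer translate of `s` lies within `1 / 2` of `t`. This half is the source of the factor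
  -- `2` in the smallness condition.
  have h1 := le_exp_mul_of_abs_deriv_le hd hpos hb (s - round (s - t)) t
  have h2 : q (s - round (s - t)) = q s := by
    have := (show Function.Periodic q 1 from hper).sub_int_mul_eq (x := s) (round (s - t))
    rwa [mul_one] at this
  rw [h2] at h1
  refine h1.trans (mul_le_mul_of_nonneg_right (Real.exp_le_exp.2 ?_) (hpos t).le)
  have h3 := abs_sub_round (s - t)
  rw [show s - ↑(round (s - t)) - t = s - t - round (s - t) by ring]
  nlinarith

/-- Average the oscillation bound `exp (a / 2)` over one argument; the factor `1 + a` absorbs the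
second-order part of the exponential. -/
theorem abs_sub_mass_le {q q₁ : ℝ → ℝ} {a r : ℝ} (ha : 0 ≤ a) (ha1 : a ≤ 1 / 10)
    (hd : ∀ t, HasDerivAt q (q₁ t) t)
    (hper : ∀ t, q (t + 1) = q t) (hpos : ∀ t, 0 < q t) (hb : ∀ t, |q₁ t| ≤ a * q t)
    (hr : ∫ y in (0 : ℝ)..1, q y = r) (t : ℝ) :
    |q t - r| ≤ r * (a / 2 * (1 + a)) := by
  have hc : Continuous q := continuous_iff_continuousAt.2 fun t => (hd t).continuousAt
  have hle := le_exp_half_mul ha hd hper hpos hb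
  have hint := hc.intervalIntegrable (μ := volume) 0 1
  have e1 : r ≤ Real.exp (a / 2) * q t := by
    rw [← hr]
    refine (intervalIntegral.integral_mono_on (g := fun _ => Real.exp (a / 2) * q t) (by norm_num)
      hint (by simp) fun y _ => hle y t).trans ?_
    simp
  have e2 : q t ≤ Real.exp (a / 2) * r := by
    rw [← hr, ← intervalIntegral.integral_const_mul]
    refine le_trans ?_ (intervalIntegral.integral_mono_on (f := fun _ => q t) (by norm_num)
      (by simp) (hint.const_mul _) fun y _ => hle t y)
    simp
  have hr0 : 0 ≤ r := by
    rw [← hr]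
    exact intervalIntegral.integral_nonneg (by norm_num) fun y _ => (hpos y).le
  have hexp : Real.exp (a / 2) ≤ 1 + a / 2 * (1 + a) := by
    have := Real.abs_exp_sub_one_sub_id_le (x := a / 2) (by rw [abs_of_nonneg] <;> linarith)
    have := (abs_le.1 this).2
    nlinarith
  have hexp' : 1 - a / 2 ≤ Real.exp (-(a / 2)) := by
    have := Real.add_one_le_exp (-(a / 2))
    linarith
  have e3 : Real.exp (-(a / 2)) * r ≤ q t := by
    rw [Real.exp_neg, inv_mul_le_iff₀ (Real.exp_pos _)]
    exact e1
  have e4 := mul_le_mul_of_nonneg_right hexp' hr0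
  have e5 := mul_le_mul_of_nonneg_right hexp hr0
  have e6 : 0 ≤ r * (a * a) := by positivity
  rw [abs_le]
  constructor <;> nlinarith

end Harnack

/-! ### Pointwise estimates -/

section Pointwise

theorem inv_one_add_bounds {z η : ℝ} (hη : η ≤ 1 / 10) (hz : |z| ≤ η) :
    1 - η ≤ (1 + z)⁻¹ ∧ (1 + z)⁻¹ ≤ 1 + 10 / 9 * η := by
  obtain ⟨h1, h2⟩ := abs_le.1 hz
  have hη0 : 0 ≤ η := (abs_nonneg _).trans hz
  have h0 : 0 < 1 + z := by linarith
  constructor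
  · rw [le_inv_comm₀ (by linarith) h0, inv_eq_one_div, le_div_iff₀ (by linarith)]
    nlinarith
  · rw [inv_le_comm₀ h0 (by linarith), inv_eq_one_div, div_le_iff₀ (by linarith)]
    nlinarith

theorem abs_inv_one_add_sub_le {z w d : ℝ} (hz : |z| ≤ 1 / 10) (hw : |w| ≤ 1 / 10)
    (h : |z - w| ≤ d) : |(1 + z)⁻¹ - (1 + w)⁻¹| ≤ 5 / 4 * d := by
  obtain ⟨h1, h1'⟩ := inv_one_add_bounds le_rfl hz
  obtain ⟨h2, h2'⟩ := inv_one_add_bounds le_rfl hw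
  have hz0 : 1 + z ≠ 0 := by linarith [(abs_le.1 hz).1]
  have hw0 : 1 + w ≠ 0 := by linarith [(abs_le.1 hw).1]
  have e : (1 + z)⁻¹ - (1 + w)⁻¹ = (w - z) * ((1 + z)⁻¹ * (1 + w)⁻¹) := by
    field_simp
    ring
  have h0 : 0 ≤ (1 + z)⁻¹ * (1 + w)⁻¹ :=
    mul_nonneg (le_trans (by norm_num) h1) (le_trans (by norm_num) h2)
  rw [e, abs_mul, abs_sub_comm, abs_of_nonneg h0]
  have h3 : (1 + z)⁻¹ * (1 + w)⁻¹ ≤ 5 / 4 := by nlinarith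
  have := mul_le_mul h h3 h0 ((abs_nonneg _).trans h)
  linarith

theorem abs_add_four_le {b c d e B C D E : ℝ} (hb : |b| ≤ B) (hc : |c| ≤ C) (hd : |d| ≤ D)
    (he : |e| ≤ E) : |b + c + d + e| ≤ B + C + D + E := by
  rw [abs_le] at *
  constructor <;> linarith

theorem abs_mul_le_mul {b c B C : ℝ} (hb : |b| ≤ B) (hc : |c| ≤ C) : |b * c| ≤ B * C := by
  rw [abs_mul]
  exact mul_le_mul hb hc (abs_nonneg _) ((abs_nonneg _).trans hb)

/-- Here `x`, `y` stand for `(1 + h')⁻¹` for the two fields and `η` for `N * a`. A telescoping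
splits the expression so that each term contains one small difference. Only the terms with `p₁ - β *
q₁` and `h₂ - β * l₂` are of first order in `a`; the others are of second order once `η = N * a`. -/
theorem abs_deriv_combination_le {p q p₁ q₁ h₂ l₂ x y β r a η Θ : ℝ}
    (hβ0 : 0 ≤ β) (hβ1 : β ≤ 1) (hr : 0 ≤ r) (ha : 0 ≤ a) (hη0 : 0 ≤ η) (hη : η ≤ 1 / 10)
    (hpq : |p - q| ≤ 11 / 10 * (r * a)) (hq₁ : |q₁| ≤ 11 / 10 * a)
    (hq : |q| ≤ 11 / 10) (hp : |p| ≤ 1 + a) (h1 : |p₁ - β * q₁| ≤ a * (r * (1 + a)))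
    (h2 : |h₂ - β * l₂| ≤ Θ * (r * (a / 2 * (1 + a)))) (hl : |l₂| ≤ η)
    (hxy : |x - y| ≤ 7 / 5 * (η * r)) (hx0 : 0 ≤ x) (hx : x ≤ 1 + 10 / 9 * η) (hy0 : 0 ≤ y)
    (hy : y ≤ 1 + 10 / 9 * η) :
    |(p₁ * x ^ 2 - p * h₂ * x ^ 3) - β * (q₁ * y ^ 2 - q * l₂ * y ^ 3)| ≤
      a * r * ((1 + a) * (1 + 3 * η)) + 5 * (a * η * r)
        + Θ / 2 * (a * r * ((1 + a) ^ 2 * (1 + 4 * η))) + η * r * (2 * a + 9 * η) := by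
  have hx2 : |x ^ 2| ≤ 1 + 3 * η := by
    rw [abs_of_nonneg (by positivity)]
    nlinarith
  have hxx : x ≤ 10 / 9 := by linarith [hx, hη, show (10 : ℝ) / 9 * (1 / 10) = 1 / 9 by norm_num]
  have hyy : y ≤ 10 / 9 := by linarith [hy, hη, show (10 : ℝ) / 9 * (1 / 10) = 1 / 9 by norm_num]
  have hx3 : |x ^ 3| ≤ 1 + 4 * η := by
    rw [abs_of_nonneg (by positivity)]
    calc x ^ 3 ≤ (1 + 10 / 9 * η) ^ 3 := by gcongr
      _ ≤ 1 + 4 * η := by nlinarith [mul_nonneg hη0 hη0]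
  have hd2 : |x ^ 2 - y ^ 2| ≤ 7 / 5 * (η * r) * (20 / 9) := by
    rw [show x ^ 2 - y ^ 2 = (x - y) * (x + y) by ring]
    refine abs_mul_le_mul hxy ?_
    rw [abs_of_nonneg (by positivity)]
    linarith
  have hd3 : |x ^ 3 - y ^ 3| ≤ 7 / 5 * (η * r) * 4 := by
    rw [show x ^ 3 - y ^ 3 = (x - y) * (x ^ 2 + x * y + y ^ 2) by ring]
    refine abs_mul_le_mul hxy ?_
    rw [abs_of_nonneg (by positivity)]
    nlinarith [mul_le_mul hxx hyy hy0 (by norm_num)]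
  have t1 := abs_mul_le_mul h1 hx2
  have t2 := abs_mul_le_mul (abs_mul_le_mul ((abs_of_nonneg hβ0).trans_le hβ1) hq₁) hd2
  have t3 : |(-(p * x ^ 3)) * (h₂ - β * l₂)| ≤ _ :=
    abs_mul_le_mul ((abs_neg _).trans_le (abs_mul_le_mul hp hx3)) h2
  have t4' : |p * x ^ 3 - q * y ^ 3| ≤ 2 * (r * a) + 9 * (η * r) := by
    rw [show p * x ^ 3 - q * y ^ 3 = (p - q) * x ^ 3 + q * (x ^ 3 - y ^ 3) by ring]
    refine (abs_add_le _ _).trans ?_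
    have s1 := abs_mul_le_mul hpq hx3
    have s2 := abs_mul_le_mul hq hd3
    have s3 : 0 ≤ r * a := by positivity
    have s4 : 0 ≤ η * r := by positivity
    nlinarith
  have t4 : |(-β * l₂) * (p * x ^ 3 - q * y ^ 3)| ≤ _ :=
    abs_mul_le_mul (abs_mul_le_mul ((abs_neg _).trans_le ((abs_of_nonneg hβ0).trans_le hβ1)) hl) t4'
  have := abs_add_four_le t1 t2 t3 t4
  rw [show (p₁ * x ^ 2 - p * h₂ * x ^ 3) - β * (q₁ * y ^ 2 - q * l₂ * y ^ 3)
    = (p₁ - β * q₁) * x ^ 2 + β * q₁ * (x ^ 2 - y ^ 2) + -(p * x ^ 3) * (h₂ - β * l₂)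
      + -β * l₂ * (p * x ^ 3 - q * y ^ 3) by ring]
  refine this.trans ?_
  have s3 : 0 ≤ a * η * r := by positivity
  have e2 : 1 * (11 / 10 * a) * (7 / 5 * (η * r) * (20 / 9)) ≤ 5 * (a * η * r) := by nlinarith
  have e1 : a * (r * (1 + a)) * (1 + 3 * η) = a * r * ((1 + a) * (1 + 3 * η)) := by ring
  have e3 : (1 + a) * (1 + 4 * η) * (Θ * (r * (a / 2 * (1 + a))))
    = Θ / 2 * (a * r * ((1 + a) ^ 2 * (1 + 4 * η))) := by ring
  have e4 : 1 * η * (2 * (r * a) + 9 * (η * r)) = η * r * (2 * a + 9 * η) := by ring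
  linarith

theorem combination_lower_bound {p q x y β r a η : ℝ}
    (hβ0 : 0 ≤ β) (hβ1 : β ≤ 1) (hr : 0 ≤ r) (ha1 : a ≤ 1 / 10)
    (hη0 : 0 ≤ η) (hη : η ≤ 1 / 10)
    (hq : |q| ≤ 11 / 10) (h1 : r * (1 - a) ≤ p - β * q)
    (hxy : |x - y| ≤ 7 / 5 * (η * r)) (hx : 1 - η ≤ x) :
    r * ((1 - a) * (1 - η)) - 2 * (η * r) ≤ p * x - β * (q * y) := by
  rw [show p * x - β * (q * y) = (p - β * q) * x + β * (q * (x - y)) by ring]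
  have s1 : r * (1 - a) * (1 - η) ≤ (p - β * q) * x :=
    mul_le_mul h1 hx (by linarith) (le_trans (mul_nonneg hr (by linarith)) h1)
  have s2 := abs_mul_le_mul ((abs_of_nonneg hβ0).trans_le hβ1) (abs_mul_le_mul hq hxy)
  have s3 := (abs_le.1 s2).1
  have s4 : 0 ≤ η * r := by positivity
  nlinarith

/-- Field terms are absorbed through `4 * η ≤ α`. The target `3 * α` suffices because two
differentiations later gain `k ^ 2 ≥ 4`. -/
theorem abs_second_deriv_le {p p₁ p₂ h₂ h₃ x a η α : ℝ} (ha1 : a ≤ 1 / 10)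
    (hη0 : 0 ≤ η) (hη : η ≤ 1 / 10) (hα : 4 * η ≤ α) (hp : |p| ≤ 53 / 50)
    (hp₁ : |p₁| ≤ 11 / 10 * a) (hp₂ : |p₂| ≤ 53 / 50 * α) (hh₂ : |h₂| ≤ η) (hh₃ : |h₃| ≤ η)
    (hx0 : 0 ≤ x) (hx : x ≤ 10 / 9) :
    |p₂ * x ^ 3 - 3 * (p₁ * h₂) * x ^ 4 - p * h₃ * x ^ 4 + 3 * (p * h₂ ^ 2) * x ^ 5| ≤ 3 * α := by
  have hx3 : |x ^ 3| ≤ 7 / 5 := by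
    rw [abs_of_nonneg (by positivity)]
    exact (pow_le_pow_left₀ hx0 hx 3).trans (by norm_num)
  have hx4 : |x ^ 4| ≤ 8 / 5 := by
    rw [abs_of_nonneg (by positivity)]
    exact (pow_le_pow_left₀ hx0 hx 4).trans (by norm_num)
  have hx5 : |x ^ 5| ≤ 2 := by
    rw [abs_of_nonneg (by positivity)]
    exact (pow_le_pow_left₀ hx0 hx 5).trans (by norm_num)
  have t1 := abs_mul_le_mul hp₂ hx3
  have t2 : |(-3 * (p₁ * h₂)) * x ^ 4| ≤ _ := abs_mul_le_mul
    (abs_mul_le_mul (by norm_num : |(-3 : ℝ)| ≤ 3) (abs_mul_le_mul hp₁ hh₂)) hx4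
  have t3 : |(-(p * h₃)) * x ^ 4| ≤ _ :=
    abs_mul_le_mul ((abs_neg _).trans_le (abs_mul_le_mul hp hh₃)) hx4
  have t4 : |(3 * (p * (h₂ * h₂))) * x ^ 5| ≤ _ := abs_mul_le_mul (abs_mul_le_mul
    (by norm_num : |(3 : ℝ)| ≤ 3) (abs_mul_le_mul hp (abs_mul_le_mul hh₂ hh₂))) hx5
  have := abs_add_four_le t1 t2 t3 t4
  rw [show p₂ * x ^ 3 - 3 * (p₁ * h₂) * x ^ 4 - p * h₃ * x ^ 4 + 3 * (p * h₂ ^ 2) * x ^ 5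
    = p₂ * x ^ 3 + -3 * (p₁ * h₂) * x ^ 4 + -(p * h₃) * x ^ 4 + 3 * (p * (h₂ * h₂)) * x ^ 5
      by ring]
  refine this.trans ?_
  have e1 : a * η ≤ 1 / 10 * η := mul_le_mul_of_nonneg_right ha1 hη0
  have e2 : η * η ≤ 1 / 10 * η := mul_le_mul_of_nonneg_right hη hη0
  nlinarith

end Pointwise

/-! ### The self-consistent operator on periodic densities of the line -/

section Line

/-- The lift to the line of the self-consistent transfer operator. -/
noncomputable def lineOp (k : ℕ) (K : ℕ → ℝ → ℝ → ℝ) (p : ℝ → ℝ) : ℝ → ℝ :=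
  branchAvg k fun x => shiftDensity p (meanField (K 1) p) (invShift (meanField (K 0) p) x)

/-- The derivative of `lineOp k K p`. -/
noncomputable def lineOpDeriv (k : ℕ) (K : ℕ → ℝ → ℝ → ℝ) (p : ℝ → ℝ) (x : ℝ) : ℝ :=
  branchAvg k (fun x => shiftDeriv p (deriv p) (meanField (K 1) p) (meanField (K 2) p)
    (invShift (meanField (K 0) p) x)) x / k

/-- The second derivative of `lineOp k K p`. -/
noncomputable def lineOpDeriv₂ (k : ℕ) (K : ℕ → ℝ → ℝ → ℝ) (p : ℝ → ℝ) (x : ℝ) : ℝ :=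
  branchAvg k (fun x => shiftDeriv₂ p (deriv p) (deriv (deriv p)) (meanField (K 1) p)
    (meanField (K 2) p) (meanField (K 3) p) (invShift (meanField (K 0) p) x)) x / k / k

/-- Periodic probability densities on the line satisfying the bounds of the two cones. -/
structure LineDensity (a α : ℝ) (p : ℝ → ℝ) : Prop where
  contDiff : ContDiff ℝ 2 p
  periodic : ∀ t, p (t + 1) = p t
  pos : ∀ t, 0 < p t
  abs_deriv_le : ∀ t, |deriv p t| ≤ a * p t
  abs_deriv_deriv_le : ∀ t, |deriv (deriv p) t| ≤ α * p t
  mass : ∫ y in (0 : ℝ)..1, p y = 1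

/-- Upper bound, in units of `a (1 - β)`, for the derivative of the image of `p - β q`. -/
noncomputable def derivFactor (N Θ a : ℝ) : ℝ :=
  (1 + a) * (1 + 3 * (N * a)) + 5 * (N * a) + Θ / 2 * ((1 + a) ^ 2 * (1 + 4 * (N * a)))
    + N * (2 * a + 9 * (N * a)) + 5 * ((4 * N + 1) * (N * a))

/-- Lower bound, in units of `1 - β`, for the image of `p - β q`. -/
noncomputable def valueFactor (N a : ℝ) : ℝ := (1 - a) * (1 - N * a) - 3 * (N * a)

/-- The smallness conditions on the parameter `a` of the cone. -/
structure SmallParam (k : ℕ) (N Θ a lam : ℝ) : Prop where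
  one_lt : 1 < k
  a_pos : 0 < a
  a_le : a ≤ 1 / 10
  mul_le : N * a ≤ 1 / 10
  lam_nonneg : 0 ≤ lam
  lam_lt : lam < 1
  half_le : 1 / 2 ≤ valueFactor N a
  factor_le : derivFactor N Θ a ≤ k * lam * valueFactor N a

namespace LineDensity

variable {a α : ℝ} {p q : ℝ → ℝ} (D : LineDensity a α p)
include D

theorem continuous : Continuous p := D.contDiff.continuous

theorem hasDerivAt (t : ℝ) : HasDerivAt p (deriv p t) t :=
  (D.contDiff.differentiable (by norm_num) t).hasDerivAt

theorem contDiff_deriv : ContDiff ℝ 1 (deriv p) :=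
  ((contDiff_succ_iff_deriv (n := 1)).1 D.contDiff).2.2

theorem hasDerivAt_deriv (t : ℝ) : HasDerivAt (deriv p) (deriv (deriv p) t) t :=
  (D.contDiff_deriv.differentiable (by norm_num) t).hasDerivAt

theorem continuous_deriv_deriv : Continuous (deriv (deriv p)) :=
  (contDiff_one_iff_deriv.1 D.contDiff_deriv).2

variable (ha : 0 < a) (ha1 : a ≤ 1 / 10)
include ha ha1

theorem abs_sub_one_le (t : ℝ) : |p t - 1| ≤ a / 2 * (1 + a) := by
  simpa using abs_sub_mass_le ha.le ha1 D.hasDerivAt D.periodic D.pos D.abs_deriv_le D.mass t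

theorem le_apply (t : ℝ) : 47 / 50 ≤ p t := by
  have := (abs_le.1 (D.abs_sub_one_le ha ha1 t)).1
  nlinarith

theorem abs_apply_le (t : ℝ) : |p t| ≤ 53 / 50 := by
  have := (abs_le.1 (D.abs_sub_one_le ha ha1 t)).2
  rw [abs_of_pos (D.pos t)]
  nlinarith

theorem abs_apply_le_one_add (t : ℝ) : |p t| ≤ 1 + a := by
  have := (abs_le.1 (D.abs_sub_one_le ha ha1 t)).2
  rw [abs_of_pos (D.pos t)]
  nlinarith

theorem abs_deriv_le_mul (t : ℝ) : |deriv p t| ≤ 11 / 10 * a := by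
  have h1 := D.abs_deriv_le t
  have h2 := (le_abs_self _).trans (D.abs_apply_le ha ha1 t)
  nlinarith

end LineDensity

variable {k : ℕ} {K : ℕ → ℝ → ℝ → ℝ} {N Θ a α lam : ℝ} {p q : ℝ → ℝ}

theorem LineDensity.meanField_eq (D : LineDensity a α p) (i : ℕ) (t : ℝ) :
    meanField (K i) p t = ∫ y in (0 : ℝ)..1, K i t y * p y := by
  rw [meanField, D.mass, div_one]

theorem shiftDeriv_eq (p p₁ h₁ h₂ : ℝ → ℝ) (t : ℝ) : shiftDeriv p p₁ h₁ h₂ t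
    = p₁ t * (1 + h₁ t)⁻¹ ^ 2 - p t * h₂ t * (1 + h₁ t)⁻¹ ^ 3 := by
  simp only [shiftDeriv, div_eq_mul_inv, inv_pow]

section Bounds

variable (hK : KernelBounds K N Θ) (hs : SmallParam k N Θ a lam)
include hK hs

theorem SmallParam.mul_nonneg : 0 ≤ N * a := by
  have := hK.nonneg
  have := hs.a_pos
  positivity

theorem LineDensity.abs_meanField_le (D : LineDensity a α p) {i : ℕ} (hi : i ≤ 3) (t : ℝ) :
    |meanField (K i) p t| ≤ N * a := by
  rw [D.meanField_eq]
  have ha := hs.a_pos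
  have ha1 := hs.a_le
  refine (hK.abs_integral_mul_le hi D.continuous (D.abs_sub_one_le ha ha1) t).trans ?_
  refine mul_le_mul_of_nonneg_left ?_ hK.nonneg
  nlinarith

theorem LineDensity.smallShift (D : LineDensity a α p) :
    SmallShift (meanField (K 0) p) (meanField (K 1) p) where
  hasDerivAt := hK.hasDerivAt_meanField (by norm_num) D.continuous
  continuous_deriv := hK.continuous_meanField (by norm_num) D.continuous
  periodic := hK.meanField_periodic p
  bound t := (D.abs_meanField_le hK hs (by norm_num) t).trans hs.mul_le

theorem LineDensity.inv_bounds (D : LineDensity a α p) (t : ℝ) :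
    1 - N * a ≤ (1 + meanField (K 1) p t)⁻¹ ∧
      (1 + meanField (K 1) p t)⁻¹ ≤ 1 + 10 / 9 * (N * a) :=
  inv_one_add_bounds hs.mul_le (D.abs_meanField_le hK hs (by norm_num) t)

theorem LineDensity.inv_bounds_num (D : LineDensity a α p) (t : ℝ) :
    0 ≤ (1 + meanField (K 1) p t)⁻¹ ∧ (1 + meanField (K 1) p t)⁻¹ ≤ 10 / 9 := by
  obtain ⟨h1, h2⟩ := D.inv_bounds hK hs t
  have := hs.mul_le
  constructor <;> linarith

theorem LineDensity.hasDerivAt_density (D : LineDensity a α p) (t : ℝ) :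
    HasDerivAt (shiftDensity p (meanField (K 1) p))
      (shiftDeriv p (deriv p) (meanField (K 1) p) (meanField (K 2) p) t
        * (1 + meanField (K 1) p t)) t :=
  hasDerivAt_shiftDensity (D.hasDerivAt t)
    (hK.hasDerivAt_meanField (by norm_num) D.continuous t)
    ((D.smallShift hK hs).one_add_pos t).ne'

theorem LineDensity.hasDerivAt_shiftDeriv (D : LineDensity a α p) (t : ℝ) :
    HasDerivAt (shiftDeriv p (deriv p) (meanField (K 1) p) (meanField (K 2) p))
      (shiftDeriv₂ p (deriv p) (deriv (deriv p)) (meanField (K 1) p) (meanField (K 2) p)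
        (meanField (K 3) p) t * (1 + meanField (K 1) p t)) t :=
  SelfConsistent.hasDerivAt_shiftDeriv (D.hasDerivAt t) (D.hasDerivAt_deriv t)
    (hK.hasDerivAt_meanField (by norm_num) D.continuous t)
    (hK.hasDerivAt_meanField (by norm_num) D.continuous t)
    ((D.smallShift hK hs).one_add_pos t).ne'

theorem LineDensity.hasDerivAt_lineOp (D : LineDensity a α p) (x : ℝ) :
    HasDerivAt (lineOp k K p) (lineOpDeriv k K p x) x :=
  hasDerivAt_branchAvg
    ((D.smallShift hK hs).hasDerivAt_comp_invShift (D.hasDerivAt_density hK hs)) x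

theorem LineDensity.hasDerivAt_lineOpDeriv (D : LineDensity a α p) (x : ℝ) :
    HasDerivAt (lineOpDeriv k K p) (lineOpDeriv₂ k K p x) x :=
  (hasDerivAt_branchAvg
    ((D.smallShift hK hs).hasDerivAt_comp_invShift (D.hasDerivAt_shiftDeriv hK hs)) x).div_const _

theorem LineDensity.continuous_lineOpDeriv₂ (D : LineDensity a α p) :
    Continuous (lineOpDeriv₂ k K p) := by
  have S := D.smallShift hK hs
  have hne : ∀ n t, (1 + meanField (K 1) p t) ^ n ≠ 0 := fun n t =>
    pow_ne_zero n (S.one_add_pos t).ne'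
  have h1 := S.continuous_deriv
  have h2 := hK.continuous_meanField (i := 2) (by norm_num) D.continuous
  have h3 := hK.continuous_meanField (i := 3) (by norm_num) D.continuous
  have hp := D.continuous
  have hp1 := D.contDiff_deriv.continuous
  have hp2 := D.continuous_deriv_deriv
  have hc : Continuous (shiftDeriv₂ p (deriv p) (deriv (deriv p)) (meanField (K 1) p)
      (meanField (K 2) p) (meanField (K 3) p)) := by
    unfold shiftDeriv₂
    refine ((Continuous.sub (Continuous.sub ?_ ?_) ?_)).add ?_ <;>
      refine Continuous.div (by fun_prop) (by fun_prop) (hne _)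
  exact ((continuous_branchAvg (hc.comp S.continuous_invShift)).div_const _).div_const _

theorem LineDensity.abs_shiftDeriv₂_le (D : LineDensity a ((4 * N + 1) * a) p) (t : ℝ) :
    |shiftDeriv₂ p (deriv p) (deriv (deriv p)) (meanField (K 1) p) (meanField (K 2) p)
      (meanField (K 3) p) t| ≤ 3 * ((4 * N + 1) * a) := by
  have ha := hs.a_pos
  have ha1 := hs.a_le
  obtain ⟨hx0, hx⟩ := D.inv_bounds_num hK hs t
  have hα : 0 ≤ (4 * N + 1) * a := by have := hK.nonneg; positivity
  have := abs_second_deriv_le (x := (1 + meanField (K 1) p t)⁻¹) (p := p t) (p₁ := deriv p t)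
    (p₂ := deriv (deriv p) t) (h₂ := meanField (K 2) p t) (h₃ := meanField (K 3) p t)
    ha1 (hs.mul_nonneg hK) hs.mul_le (by linarith : 4 * (N * a) ≤ (4 * N + 1) * a)
    (D.abs_apply_le ha ha1 t) (D.abs_deriv_le_mul ha ha1 t)
    ((D.abs_deriv_deriv_le t).trans (by
      have := (le_abs_self _).trans (D.abs_apply_le ha ha1 t)
      nlinarith))
    (D.abs_meanField_le hK hs (by norm_num) t) (D.abs_meanField_le hK hs (by norm_num) t) hx0 hx
  simpa only [shiftDeriv₂, div_eq_mul_inv, inv_pow] using this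

theorem LineDensity.abs_shiftDeriv_le (D : LineDensity a α p) (t : ℝ) :
    |shiftDeriv p (deriv p) (meanField (K 1) p) (meanField (K 2) p) t| ≤ 9 / 25 := by
  have ha := hs.a_pos
  have ha1 := hs.a_le
  obtain ⟨hx0, hx⟩ := D.inv_bounds_num hK hs t
  rw [shiftDeriv_eq]
  set x := (1 + meanField (K 1) p t)⁻¹
  have hx2 : |x ^ 2| ≤ 5 / 4 := by
    rw [abs_of_nonneg (by positivity)]
    exact (pow_le_pow_left₀ hx0 hx 2).trans (by norm_num)
  have hx3 : |x ^ 3| ≤ 7 / 5 := by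
    rw [abs_of_nonneg (by positivity)]
    exact (pow_le_pow_left₀ hx0 hx 3).trans (by norm_num)
  have t1 := abs_mul_le_mul (D.abs_deriv_le_mul ha ha1 t) hx2
  have t2 := abs_mul_le_mul (abs_mul_le_mul (D.abs_apply_le ha ha1 t)
    (D.abs_meanField_le hK hs (i := 2) (by norm_num) t)) hx3
  have h3 := hs.mul_le
  rw [abs_le] at *
  constructor <;> linarith

/-- This is where the cone `𝒞_α` is needed in the comparison: the inverse shifts of `p` and `q`
reach different points, and moving a first derivative between them costs a second derivative. -/
theorem LineDensity.abs_shiftDeriv_sub_le (D : LineDensity a ((4 * N + 1) * a) p) (s t : ℝ) :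
    |shiftDeriv p (deriv p) (meanField (K 1) p) (meanField (K 2) p) s
      - shiftDeriv p (deriv p) (meanField (K 1) p) (meanField (K 2) p) t|
      ≤ 3 * ((4 * N + 1) * a) * (11 / 10) * |s - t| := by
  have S := D.smallShift hK hs
  have := Convex.norm_image_sub_le_of_norm_hasDerivWithin_le
    (C := 3 * ((4 * N + 1) * a) * (11 / 10))
    (s := univ) (x := t) (y := s) (fun x _ => (D.hasDerivAt_shiftDeriv hK hs x).hasDerivWithinAt)
    (fun x _ => abs_mul_le_mul (D.abs_shiftDeriv₂_le hK hs x)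
      ((abs_of_pos (S.one_add_pos x)).trans_le (S.one_add_le x)))
    convex_univ (mem_univ _) (mem_univ _)
  simpa using this

theorem LineDensity.abs_shiftDensity_sub_le (D : LineDensity a α p) (s t : ℝ) :
    |shiftDensity p (meanField (K 1) p) s - shiftDensity p (meanField (K 1) p) t|
      ≤ 9 / 25 * (11 / 10) * |s - t| := by
  have S := D.smallShift hK hs
  have := Convex.norm_image_sub_le_of_norm_hasDerivWithin_le (C := 9 / 25 * (11 / 10))
    (s := univ) (x := t) (y := s) (fun x _ => (D.hasDerivAt_density hK hs x).hasDerivWithinAt)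
    (fun x _ => abs_mul_le_mul (D.abs_shiftDeriv_le hK hs x)
      ((abs_of_pos (S.one_add_pos x)).trans_le (S.one_add_le x)))
    convex_univ (mem_univ _) (mem_univ _)
  simpa using this

/-- The image of `p - β q` under coupling, for the mean fields of `p` and of `q`, and its
derivative. -/
theorem LineDensity.shift_combination_bounds (D : LineDensity a ((4 * N + 1) * a) p)
    (D' : LineDensity a ((4 * N + 1) * a) q) {β : ℝ} (hβ0 : 0 ≤ β)
    (hpos : ∀ t, 0 < p t - β * q t)
    (hder : ∀ t, |deriv p t - β * deriv q t| ≤ a * (p t - β * q t)) (x : ℝ) :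
    (1 - β) * valueFactor N a ≤
        shiftDensity p (meanField (K 1) p) (invShift (meanField (K 0) p) x)
          - β * shiftDensity q (meanField (K 1) q) (invShift (meanField (K 0) q) x) ∧
      |shiftDeriv p (deriv p) (meanField (K 1) p) (meanField (K 2) p)
            (invShift (meanField (K 0) p) x)
          - β * shiftDeriv q (deriv q) (meanField (K 1) q) (meanField (K 2) q)
            (invShift (meanField (K 0) q) x)| ≤ a * (1 - β) * derivFactor N Θ a := by
  have ha := hs.a_pos
  have ha1 := hs.a_le
  have hη := hs.mul_le
  have hη0 := hs.mul_nonneg hK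
  have S := D.smallShift hK hs
  have S' := D'.smallShift hK hs
  have hmass : ∫ y in (0 : ℝ)..1, (p y - β * q y) = 1 - β := by
    rw [intervalIntegral.integral_sub (D.continuous.intervalIntegrable _ _)
      ((D'.continuous.const_mul β).intervalIntegrable _ _), intervalIntegral.integral_const_mul,
      D.mass, D'.mass, mul_one]
  -- The combination itself satisfies the cone inequality and has mass `1 - β`, so it oscillates
  -- proportionally to `1 - β`.
  have hcomb := abs_sub_mass_le (q := fun t => p t - β * q t)
    (q₁ := fun t => deriv p t - β * deriv q t) ha.le ha1
    (fun t => (D.hasDerivAt t).sub ((D'.hasDerivAt t).const_mul β))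
    (fun t => by rw [D.periodic, D'.periodic]) hpos hder hmass
  have hr : 0 ≤ 1 - β := by
    rw [← hmass]
    exact intervalIntegral.integral_nonneg (by norm_num) fun y _ => (hpos y).le
  set r := 1 - β with hrdef
  have hβ1 : β ≤ 1 := by linarith
  have hra : 0 ≤ r * a := by positivity
  have hraa : r * (a * a) ≤ r * (a * (1 / 10)) := by gcongr
  have hpq : ∀ t, |p t - q t| ≤ 11 / 10 * (r * a) := fun t => by
    have h1 := hcomb t
    have h2 := abs_mul_le_mul (abs_of_nonneg hr).le (D'.abs_sub_one_le ha ha1 t)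
    -- Both parts carry the factor `r`, so errors due to differing fields vanish with `1 - β`, as
    -- the improvement requires.
    rw [show p t - q t = (p t - β * q t - r) - r * (q t - 1) by rw [hrdef]; ring]
    refine (abs_sub _ _).trans ?_
    nlinarith
  have hfield : ∀ i, i ≤ 3 → ∀ t, |meanField (K i) p t - meanField (K i) q t|
      ≤ 11 / 10 * (N * a * r) := fun i hi t => by
    have hcp : Continuous fun y => K i t y * p y := (hK.continuous_right hi t).mul D.continuous
    have hcq : Continuous fun y => K i t y * q y := (hK.continuous_right hi t).mul D'.continuous
    rw [D.meanField_eq, D'.meanField_eq, ← intervalIntegral.integral_sub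
      (hcp.intervalIntegrable _ _) (hcq.intervalIntegrable _ _)]
    have := hK.abs_integral_mul_le hi (q := fun y => p y - q y)
      (D.continuous.sub D'.continuous) (c := 0) (fun y => by simpa using hpq y) t
    simp only [mul_sub] at this
    refine this.trans (le_of_eq ?_)
    ring
  have hfield₂ : ∀ t, |meanField (K 2) p t - β * meanField (K 2) q t|
      ≤ Θ * (r * (a / 2 * (1 + a))) := fun t => by
    have hcr := hK.continuous_right (i := 2) (by norm_num) t
    have hcp : Continuous fun y => K 2 t y * p y := hcr.mul D.continuous
    have hcq : Continuous fun y => β * (K 2 t y * q y) := (hcr.mul D'.continuous).const_mul β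
    rw [D.meanField_eq, D'.meanField_eq, ← intervalIntegral.integral_const_mul,
      ← intervalIntegral.integral_sub (hcp.intervalIntegrable _ _) (hcq.intervalIntegrable _ _)]
    have := hK.abs_integral_mul_le_l1 (i := 2) (by norm_num) (q := fun y => p y - β * q y)
      (D.continuous.sub (D'.continuous.const_mul β)) hcomb t
    refine le_trans (le_of_eq ?_) (this.trans
      (mul_le_mul_of_nonneg_right (hK.l1_bound t) (by positivity)))
    congr 2
    funext y
    ring
  have hσ := S.abs_invShift_sub_invShift_le S' (hfield 0 (by norm_num)) x
  set s := invShift (meanField (K 0) p) x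
  set s' := invShift (meanField (K 0) q) x
  obtain ⟨hx1, hx2⟩ := D.inv_bounds hK hs s
  -- Both densities are first compared at the same point `s`; the displacement of `q` from `s` to
  -- `s'` is paid for separately below.
  obtain ⟨hy1, hy2⟩ := D'.inv_bounds hK hs s
  have hxy := abs_inv_one_add_sub_le (S.bound s) (S'.bound s) (hfield 1 (by norm_num) s)
  have hηr : 0 ≤ N * a * r := by positivity
  have hxy' : |(1 + meanField (K 1) p s)⁻¹ - (1 + meanField (K 1) q s)⁻¹|
      ≤ 7 / 5 * (N * a * r) := hxy.trans (by linarith)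
  have hqs : |q s| ≤ 11 / 10 := (D'.abs_apply_le ha ha1 s).trans (by norm_num)
  have hβabs : |β| ≤ 1 := (abs_of_nonneg hβ0).trans_le hβ1
  constructor
  · have h1 := combination_lower_bound (p := p s) (q := q s) hβ0 hβ1 hr ha1 hη0 hη hqs
      (by have := (abs_le.1 (hcomb s)).1; nlinarith) hxy' hx1
    have h2 := abs_mul_le_mul hβabs (D'.abs_shiftDensity_sub_le hK hs s s')
    have h3 := (abs_le.1 h2).1
    simp only [shiftDensity, div_eq_mul_inv, valueFactor] at *
    linarith
  · have h1 := abs_deriv_combination_le (p := p s) (q := q s) (p₁ := deriv p s)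
      (q₁ := deriv q s) hβ0 hβ1 hr ha.le hη0 hη (hpq s) (D'.abs_deriv_le_mul ha ha1 s) hqs
      (D.abs_apply_le_one_add ha ha1 s)
      ((hder s).trans (mul_le_mul_of_nonneg_left
        (by have := (abs_le.1 (hcomb s)).2; nlinarith) ha.le))
      (hfield₂ s) (D'.abs_meanField_le hK hs (by norm_num) s) hxy' (by linarith) hx2
      (by linarith) hy2
    -- The displacement costs a Lipschitz constant of order `a` times a distance of order `N a r`:
    -- the last term of `derivFactor`.
    have h2 := abs_mul_le_mul hβabs (D'.abs_shiftDeriv_sub_le hK hs s s')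
    rw [← shiftDeriv_eq p (deriv p) (meanField (K 1) p) (meanField (K 2) p),
      ← shiftDeriv_eq q (deriv q) (meanField (K 1) q) (meanField (K 2) q)] at h1
    have h3 := (abs_add_le _ _).trans (add_le_add h1 h2)
    rw [sub_add, ← mul_sub, sub_sub_cancel] at h3
    refine h3.trans ?_
    have hα : 0 ≤ (4 * N + 1) * a := by have := hK.nonneg; positivity
    have h4 := mul_le_mul_of_nonneg_left hσ hα
    have h5 : 0 ≤ (4 * N + 1) * a * (N * a * r) := by positivity
    have h6 : a * r * derivFactor N Θ a = a * r * ((1 + a) * (1 + 3 * (N * a)))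
        + 5 * (a * (N * a) * r) + Θ / 2 * (a * r * ((1 + a) ^ 2 * (1 + 4 * (N * a))))
        + N * a * r * (2 * a + 9 * (N * a)) + 5 * ((4 * N + 1) * a * (N * a * r)) := by
      unfold derivFactor
      ring
    rw [h6]
    linarith

/-- Averaging preserves uniform bounds, and the derivative gains `1 / k`, which `factor_le` converts
into the strict ratio `lam`. -/
theorem LineDensity.lineOp_combination_bounds (D : LineDensity a ((4 * N + 1) * a) p)
    (D' : LineDensity a ((4 * N + 1) * a) q) {β : ℝ} (hβ0 : 0 ≤ β) (hβ1 : β ≤ 1)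
    (hpos : ∀ t, 0 < p t - β * q t)
    (hder : ∀ t, |deriv p t - β * deriv q t| ≤ a * (p t - β * q t)) (x : ℝ) :
    (1 - β) * valueFactor N a ≤ lineOp k K p x - β * lineOp k K q x ∧
      |lineOpDeriv k K p x - β * lineOpDeriv k K q x|
        ≤ a * (1 - β) * (lam * valueFactor N a) := by
  have hk0 : 0 < k := by have := hs.one_lt; omega
  have hk' : (0 : ℝ) < k := by positivity
  have h := D.shift_combination_bounds hK hs D' hβ0 hpos hder
  constructor
  · have h1 := le_branchAvg hk0 (fun t => (h t).1) x
    rwa [branchAvg_sub_mul] at h1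
  · have h2 := abs_branchAvg_le hk0 (fun t => (h t).2) x
    rw [branchAvg_sub_mul] at h2
    have e : lineOpDeriv k K p x - β * lineOpDeriv k K q x
        = (branchAvg k (fun x => shiftDeriv p (deriv p) (meanField (K 1) p) (meanField (K 2) p)
            (invShift (meanField (K 0) p) x)) x
          - β * branchAvg k (fun x => shiftDeriv q (deriv q) (meanField (K 1) q)
            (meanField (K 2) q) (invShift (meanField (K 0) q) x)) x) / k := by
      unfold lineOpDeriv
      ring
    rw [e, abs_div, abs_of_pos hk', div_le_iff₀ hk']
    refine h2.trans ?_
    have h3 : 0 ≤ a * (1 - β) := mul_nonneg hs.a_pos.le (by linarith)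
    have h4 := mul_le_mul_of_nonneg_left hs.factor_le h3
    linarith

theorem LineDensity.integral_lineOp (D : LineDensity a α p) :
    ∫ y in (0 : ℝ)..1, lineOp k K p y = 1 := by
  have hk0 : 0 < k := by have := hs.one_lt; omega
  have S := D.smallShift hK hs
  have hc : Continuous fun x => shiftDensity p (meanField (K 1) p)
      (invShift (meanField (K 0) p) x) :=
    (D.continuous.div (continuous_const.add S.continuous_deriv)
      fun t => (S.one_add_pos t).ne').comp S.continuous_invShift
  have h1 := integral_mul_branchAvg hk0 (F := fun _ => 1) continuous_const hc (fun _ => rfl)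
  have h2 := S.integral_comp_shift (F := fun _ => 1) continuous_const D.continuous
    (fun _ => rfl) D.periodic
  simp only [one_mul] at h1 h2
  rw [lineOp, h1, ← h2, D.mass]

theorem LineDensity.lineOp_periodic (D : LineDensity a α p) (x : ℝ) :
    lineOp k K p (x + 1) = lineOp k K p x := by
  have hk0 : 0 < k := by have := hs.one_lt; omega
  have S := D.smallShift hK hs
  refine branchAvg_add_one hk0 (fun t => ?_) x
  simp only [S.invShift_add_one, shiftDensity, D.periodic, S.periodic_deriv]

theorem LineDensity.abs_lineOp_le (D : LineDensity a α p) (x : ℝ) :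
    |lineOp k K p x| ≤ 6 / 5 := by
  have hk0 : 0 < k := by have := hs.one_lt; omega
  refine abs_branchAvg_le hk0 (fun t => ?_) x
  rw [shiftDensity, div_eq_mul_inv]
  obtain ⟨hx0, hx⟩ := D.inv_bounds_num hK hs (invShift (meanField (K 0) p) t)
  exact (abs_mul_le_mul (D.abs_apply_le hs.a_pos hs.a_le _)
    ((abs_of_nonneg hx0).trans_le hx)).trans (by norm_num)

theorem LineDensity.le_lineOp (D : LineDensity a α p) (x : ℝ) :
    4 / 5 ≤ lineOp k K p x := by
  have hk0 : 0 < k := by have := hs.one_lt; omega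
  have S := D.smallShift hK hs
  refine le_branchAvg hk0 (fun t => ?_) x
  rw [shiftDensity, le_div_iff₀ (S.one_add_pos _)]
  have h1 := S.one_add_le (invShift (meanField (K 0) p) t)
  have h2 := D.le_apply hs.a_pos hs.a_le (invShift (meanField (K 0) p) t)
  linarith

/-- The first-derivative bound is the combination estimate with nothing subtracted; the second comes
from the gain `k ^ 2`. -/
theorem LineDensity.lineOp_lineDensity (D : LineDensity a ((4 * N + 1) * a) p) :
    LineDensity a ((4 * N + 1) * a) (lineOp k K p) := by
  have hk0 : 0 < k := by have := hs.one_lt; omega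
  have hk2 : (2 : ℝ) ≤ k := by exact_mod_cast hs.one_lt
  have ha := hs.a_pos
  have hα : 0 ≤ (4 * N + 1) * a := by have := hK.nonneg; positivity
  have d1 : deriv (lineOp k K p) = lineOpDeriv k K p :=
    funext fun x => (D.hasDerivAt_lineOp hK hs x).deriv
  have d2 : deriv (lineOpDeriv k K p) = lineOpDeriv₂ k K p :=
    funext fun x => (D.hasDerivAt_lineOpDeriv hK hs x).deriv
  have hle := D.le_lineOp hK hs
  have hb := D.lineOp_combination_bounds hK hs D (β := 0) le_rfl zero_le_one
    (fun t => by simpa using D.pos t) (fun t => by simpa using D.abs_deriv_le t)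
  refine ⟨?_, D.lineOp_periodic hK hs, fun t => by linarith [hle t], fun t => ?_, fun t => ?_,
    D.integral_lineOp hK hs⟩
  · refine (contDiff_succ_iff_deriv (n := 1)).2
      ⟨fun x => (D.hasDerivAt_lineOp hK hs x).differentiableAt, by simp, ?_⟩
    rw [d1]
    refine contDiff_one_iff_deriv.2
      ⟨fun x => (D.hasDerivAt_lineOpDeriv hK hs x).differentiableAt, ?_⟩
    rw [d2]
    exact D.continuous_lineOpDeriv₂ hK hs
  · rw [d1]
    obtain ⟨h1, h2⟩ := hb t
    simp only [sub_zero, zero_mul, mul_one, one_mul] at h1 h2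
    refine h2.trans (mul_le_mul_of_nonneg_left (le_trans ?_ h1) ha.le)
    have := hs.half_le
    nlinarith [hs.lam_lt]
  · rw [d1, d2]
    have h1 := abs_branchAvg_le hk0 (fun x => D.abs_shiftDeriv₂_le hK hs
      (invShift (meanField (K 0) p) x)) t
    rw [lineOpDeriv₂, abs_div, abs_div, abs_of_pos (by positivity : (0 : ℝ) < k), div_div,
      div_le_iff₀ (by positivity)]
    refine h1.trans ?_
    -- The image density is at least `4 / 5` and `k ^ 2 ≥ 4`, giving `16 / 5`.
    have h3 : (3 : ℝ) ≤ lineOp k K p t * (k * k) := by nlinarith [hle t]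
    have := mul_le_mul_of_nonneg_left h3 hα
    linarith

/-- If `p - β q` lies in the cone, then `β` can be improved for the images. -/
theorem LineDensity.lineOp_improve (D : LineDensity a ((4 * N + 1) * a) p)
    (D' : LineDensity a ((4 * N + 1) * a) q) {β : ℝ} (hβ0 : 0 ≤ β) (hβ1 : β < 1)
    (hpos : ∀ t, 0 < p t - β * q t)
    (hder : ∀ t, |deriv p t - β * deriv q t| ≤ a * (p t - β * q t)) (x : ℝ) :
    0 < lineOp k K p x - (β + (1 - lam) / 5 * (1 - β)) * lineOp k K q x ∧
      |deriv (lineOp k K p) x - (β + (1 - lam) / 5 * (1 - β)) * deriv (lineOp k K q) x|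
        ≤ a * (lineOp k K p x - (β + (1 - lam) / 5 * (1 - β)) * lineOp k K q x) := by
  have ha := hs.a_pos
  rw [(D.hasDerivAt_lineOp hK hs x).deriv, (D'.hasDerivAt_lineOp hK hs x).deriv]
  obtain ⟨h1, h2⟩ := D.lineOp_combination_bounds hK hs D' hβ0 hβ1.le hpos hder x
  obtain ⟨h3, h4⟩ := D'.lineOp_combination_bounds hK hs D' (β := 0) le_rfl zero_le_one
    (fun t => by simpa using D'.pos t) (fun t => by simpa using D'.abs_deriv_le t) x
  simp only [sub_zero, zero_mul, mul_one, one_mul] at h3 h4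
  have h5 := (le_abs_self _).trans (D'.abs_lineOp_le hK hs x)
  have hl1 := hs.lam_lt
  have hl0 := hs.lam_nonneg
  have hV := hs.half_le
  have hr : 0 < 1 - β := by linarith
  set r := 1 - β
  set V := valueFactor N a
  set κ := (1 - lam) / 5 with hκ
  have hκr : 0 ≤ κ * r := by
    have : 0 ≤ κ := by rw [hκ]; linarith
    positivity
  have h6 : κ * r * lineOp k K q x ≤ κ * r * (6 / 5) := mul_le_mul_of_nonneg_left h5 hκr
  -- The slack is `(1 - lam) * V ≥ (1 - lam) / 2`. Subtracting the extra multiple costs at most `12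
  -- / 5 * κ = 12 / 25 * (1 - lam)`, which explains the `5` in `κ`.
  have key : r * (lam * V * (1 + κ)) ≤ r * (V - 6 / 5 * κ) := by
    refine mul_le_mul_of_nonneg_left ?_ hr.le
    have hV2 : V ≤ 6 / 5 := h3.trans h5
    have e1 : 0 ≤ (1 - lam) * (V - 1 / 2) := mul_nonneg (by linarith) (by linarith)
    have e2 : lam * V ≤ 6 / 5 := by nlinarith
    have e3 : κ * (lam * V) ≤ κ * (6 / 5) := by gcongr
    rw [hκ] at *
    nlinarith
  have h7 : r * (V - 6 / 5 * κ) ≤ lineOp k K p x - (β + κ * r) * lineOp k K q x := by linarith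
  constructor
  · refine lt_of_lt_of_le (mul_pos hr ?_) h7
    rw [hκ]
    linarith
  · have h8 := abs_mul_le_mul (abs_of_nonneg hκr).le h4
    rw [show lineOpDeriv k K p x - (β + κ * r) * lineOpDeriv k K q x
      = (lineOpDeriv k K p x - β * lineOpDeriv k K q x) - κ * r * lineOpDeriv k K q x by ring]
    refine (abs_sub _ _).trans ((add_le_add h2 h8).trans ?_)
    refine le_trans (le_of_eq ?_) (mul_le_mul_of_nonneg_left (key.trans h7) ha.le)
    ring

end Bounds

end Line

/-- Below a threshold, every parameter of the cone is small enough. -/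
theorem exists_eventually_smallParam {k : ℕ} (hk : 1 < k) {N Θ : ℝ} (hΘ0 : 0 ≤ Θ)
    (hΘ : Θ < 2 * ((k : ℝ) - 1)) :
    ∃ lam : ℝ, ∀ᶠ a in 𝓝[>] (0 : ℝ), SmallParam k N Θ a lam := by
  have hk' : (0 : ℝ) < k := by positivity
  -- The midpoint between `1` and the limiting ratio: at `a = 0` the two factors are `1 + Θ / 2` and
  -- `1`.
  set lam := ((1 + Θ / 2) / k + 1) / 2 with hlam
  have h1 : (1 + Θ / 2) / k < 1 := by
    rw [div_lt_one hk']
    linarith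
  have h0 : 0 ≤ (1 + Θ / 2) / k := by positivity
  have hlam1 : lam < 1 := by linarith
  have hlam0 : 0 ≤ lam := by linarith
  have hklam : 1 + Θ / 2 < k * lam := by
    have : (1 + Θ / 2) / k < lam := by linarith
    rwa [div_lt_iff₀' hk'] at this
  have hcd : Continuous fun a => derivFactor N Θ a := by unfold derivFactor; fun_prop
  have hcv : Continuous fun a => valueFactor N a := by unfold valueFactor; fun_prop
  have e1 : ∀ᶠ a in 𝓝 (0 : ℝ), derivFactor N Θ a < k * lam * valueFactor N a :=
    (hcd.tendsto 0).eventually_lt ((continuous_const.mul hcv).tendsto 0)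
      (by simpa [derivFactor, valueFactor] using hklam)
  have e2 : ∀ᶠ a in 𝓝 (0 : ℝ), 1 / 2 < valueFactor N a :=
    (hcv.tendsto 0).eventually_const_lt (by norm_num [valueFactor])
  have e3 : ∀ᶠ a in 𝓝 (0 : ℝ), N * a < 1 / 10 :=
    ((continuous_const.mul continuous_id).tendsto 0).eventually_lt_const (by simp)
  have e4 : ∀ᶠ a in 𝓝 (0 : ℝ), a < 1 / 10 := eventually_lt_nhds (by norm_num)
  refine ⟨lam, ?_⟩
  filter_upwards [e1.filter_mono nhdsWithin_le_nhds, e2.filter_mono nhdsWithin_le_nhds,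
    e3.filter_mono nhdsWithin_le_nhds, e4.filter_mono nhdsWithin_le_nhds,
    self_mem_nhdsWithin] with a h1 h2 h3 h4 h5
  exact ⟨hk, h5, h4.le, h3.le, hlam0, hlam1, h2.le, h1.le⟩

/-! ### Functions on the circle and their lifts -/

section Circle

/-- The lift of a function on the circle to a periodic function of the line. -/
def circleLift (φ : UnitAddCircle → ℝ) (t : ℝ) : ℝ := φ (t : UnitAddCircle)

theorem circleLift_add_one (φ : UnitAddCircle → ℝ) (t : ℝ) :
    circleLift φ (t + 1) = circleLift φ t := by
  simp [circleLift]

theorem continuous_of_comp_coe {X : Type*} [TopologicalSpace X] {φ : UnitAddCircle → X}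
    (h : Continuous fun t : ℝ => φ (t : UnitAddCircle)) : Continuous φ :=
  (QuotientAddGroup.isOpenQuotientMap_mk.isQuotientMap.continuous_iff).2 h

theorem forall_circle {P : UnitAddCircle → Prop} : (∀ x, P x) ↔ ∀ t : ℝ, P (t : UnitAddCircle) :=
  ⟨fun h t => h t, fun h x => by
    induction x using QuotientAddGroup.induction_on with | _ t => exact h t⟩

/-- The cone says that `log φ` is `a`-Lipschitz. The infinitesimal form is what makes differences
such as `φ - β • ψ` tractable. -/
theorem mem_logLipCone_iff {a : ℝ} (ha : 0 ≤ a) {φ : UnitAddCircle → ℝ} :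
    φ ∈ logLipCone a ↔ ContDiff ℝ 1 (circleLift φ) ∧ (∀ t, 0 < circleLift φ t) ∧
      ∀ t, |deriv (circleLift φ) t| ≤ a * circleLift φ t := by
  have hC : CircleContDiff 1 φ ↔ ContDiff ℝ 1 (circleLift φ) := Iff.rfl
  have hP : (∀ x, 0 < φ x) ↔ ∀ t, 0 < circleLift φ t := forall_circle
  simp only [logLipCone, mem_ofPred_eq, hC, hP]
  refine and_congr_right fun hc => and_congr_right fun hpos => ?_
  have hd : ∀ t, HasDerivAt (circleLift φ) (deriv (circleLift φ) t) t := fun t =>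
    (hc.differentiable (by norm_num) t).hasDerivAt
  constructor
  · intro h t
    have hlog : ∀ s u, Real.log (circleLift φ s) - Real.log (circleLift φ u) ≤ a * |s - u| :=
      fun s u => by
        rw [← Real.log_div (hpos s).ne' (hpos u).ne',
          Real.log_le_iff_le_exp (div_pos (hpos s) (hpos u))]
        refine (h s u).trans (Real.exp_le_exp.2 (mul_le_mul_of_nonneg_left ?_ ha))
        -- The circle distance is at most the distance on the line: the nearest integer to `s - u`
        -- does no worse than `0`.
        rw [dist_eq_norm, ← AddCircle.coe_sub, UnitAddCircle.norm_eq]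
        simpa using round_le (s - u) 0
    have hlip : LipschitzWith a.toNNReal fun s => Real.log (circleLift φ s) := by
      refine LipschitzWith.of_dist_le_mul fun s u => ?_
      rw [Real.dist_eq, Real.dist_eq, Real.coe_toNNReal a ha, abs_le]
      have h1 := hlog s u
      have h2 := hlog u s
      rw [abs_sub_comm] at h2
      constructor <;> linarith
    have h3 := norm_deriv_le_of_lipschitz (x₀ := t) hlip
    rw [((hd t).log (hpos t).ne').deriv, Real.coe_toNNReal a ha, Real.norm_eq_abs, abs_div,
      abs_of_pos (hpos t), div_le_iff₀ (hpos t)] at h3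
    exact h3
  · intro h x y
    induction x using QuotientAddGroup.induction_on with | _ s => ?_
    induction y using QuotientAddGroup.induction_on with | _ t => ?_
    have h1 := le_exp_mul_of_abs_deriv_le hd hpos h (s - round (s - t)) t
    have h2 : circleLift φ (s - round (s - t)) = circleLift φ s := by
      have := (show Function.Periodic (circleLift φ) 1 from
        circleLift_add_one φ).sub_int_mul_eq (x := s) (round (s - t))
      rwa [mul_one] at this
    have h3 : dist (s : UnitAddCircle) (t : UnitAddCircle) = |s - round (s - t) - t| := by
      rw [dist_eq_norm, ← AddCircle.coe_sub, UnitAddCircle.norm_eq]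
      congr 1
      ring
    rw [h2, ← h3] at h1
    exact (div_le_iff₀ (hpos t)).2 h1

theorem mem_secondDerivCone_iff {α : ℝ} {φ : UnitAddCircle → ℝ} :
    φ ∈ secondDerivCone α ↔ ContDiff ℝ 2 (circleLift φ) ∧ (∀ t, 0 < circleLift φ t) ∧
      ∀ t, |deriv (deriv (circleLift φ)) t| ≤ α * circleLift φ t := by
  have hC : CircleContDiff 2 φ ↔ ContDiff ℝ 2 (circleLift φ) := Iff.rfl
  have hP : (∀ x, 0 < φ x) ↔ ∀ t, 0 < circleLift φ t := forall_circle
  simp only [secondDerivCone, mem_ofPred_eq, hC, hP]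
  refine and_congr_right fun hc => and_congr_right fun hpos => ?_
  rw [forall_circle]
  refine forall_congr' fun t => ?_
  have hc1 : ContDiff ℝ 1 (deriv (circleLift φ)) :=
    ((contDiff_succ_iff_deriv (n := 1)).1 hc).2.2
  rw [circleDeriv_two_coe (u := circleLift φ) (fun _ => rfl)
    (fun t => (hc.differentiable (by norm_num) t).hasDerivAt)
    (fun t => (hc1.differentiable (by norm_num) t).hasDerivAt), abs_div,
    show φ (t : UnitAddCircle) = circleLift φ t from rfl, abs_of_pos (hpos t),
    div_le_iff₀ (hpos t)]

theorem smul_mem_logLipCone {a : ℝ} (ha : 0 ≤ a) (c : ℝ) (hc : 0 < c) (φ : UnitAddCircle → ℝ)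
    (h : φ ∈ logLipCone a) : c • φ ∈ logLipCone a := by
  rw [mem_logLipCone_iff ha] at *
  obtain ⟨h1, h2, h3⟩ := h
  have e : circleLift (c • φ) = fun t => c * circleLift φ t := rfl
  refine ⟨contDiff_const.mul h1, fun t => mul_pos hc (h2 t), fun t => ?_⟩
  rw [e, deriv_const_mul _ (h1.differentiable (by norm_num) t), abs_mul, abs_of_pos hc]
  nlinarith [h3 t]

end Circle

/-! ### The density of the image measure -/

section Measure

theorem integral_densityMeasure {φ : UnitAddCircle → ℝ} (hφ : Continuous φ) (h0 : ∀ x, 0 ≤ φ x)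
    (f : UnitAddCircle → ℝ) :
    ∫ x, f x ∂(densityMeasure φ) = ∫ t in (0 : ℝ)..1, circleLift φ t * circleLift f t := by
  rw [densityMeasure, integral_withDensity_eq_integral_toReal_smul
    (hφ.measurable.ennreal_ofReal) (Eventually.of_forall fun _ => ENNReal.ofReal_lt_top),
    integral_circle_eq]
  refine intervalIntegral.integral_congr fun t _ => ?_
  simp only [ENNReal.toReal_ofReal (h0 _), smul_eq_mul, circleLift]

theorem isFiniteMeasure_densityMeasure {φ : UnitAddCircle → ℝ} (hφ : Continuous φ) :
    IsFiniteMeasure (densityMeasure φ) := by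
  refine isFiniteMeasure_withDensity_ofReal ?_
  obtain ⟨C, hC⟩ := isCompact_univ.exists_bound_of_continuousOn hφ.continuousOn
  exact (Integrable.of_bound hφ.aestronglyMeasurable C
    (Eventually.of_forall fun x => hC x (mem_univ x))).hasFiniteIntegral

/-- Lebesgue measure charges every open set, so a continuous density is unique; this identifies the
function picked by `Classical.epsilon`. -/
theorem densityMeasure_injective {φ ψ : UnitAddCircle → ℝ} (hφ : Continuous φ)
    (hψ : Continuous ψ) (hφ0 : ∀ x, 0 ≤ φ x) (hψ0 : ∀ x, 0 ≤ ψ x)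
    (h : densityMeasure φ = densityMeasure ψ) : φ = ψ := by
  have hfin := isFiniteMeasure_densityMeasure hφ
  unfold densityMeasure at h
  rw [withDensity_eq_iff hφ.measurable.ennreal_ofReal.aemeasurable
    hψ.measurable.ennreal_ofReal.aemeasurable] at h
  · have h1 := (Continuous.ae_eq_iff_eq volume (ENNReal.continuous_ofReal.comp hφ)
      (ENNReal.continuous_ofReal.comp hψ)).1 h
    funext x
    exact (ENNReal.ofReal_eq_ofReal_iff (hφ0 x) (hψ0 x)).1 (congrFun h1 x)
  · have := hfin.measure_univ_lt_top
    rw [densityMeasure, withDensity_apply _ MeasurableSet.univ, Measure.restrict_univ] at this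
    exact this.ne

variable {k : ℕ} {H : UnitAddCircle → UnitAddCircle → ℝ} {δ N Θ a α lam c : ℝ}
  {φ ψ : UnitAddCircle → ℝ} {p : ℝ → ℝ}

/-- Division by the total mass removes the factor `c`, so the coupling depends only on the
normalised density. -/
theorem couplingMap_coe (hc : 0 < c) (D : LineDensity a α p)
    (hφ : ∀ t, circleLift φ t = c * p t) (t : ℝ) :
    couplingMap H δ (densityMeasure φ) (t : UnitAddCircle)
      = ((t + meanField (torusKernel H δ 0) p t : ℝ) : UnitAddCircle) := by
  have hcont : Continuous φ := continuous_of_comp_coe (by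
    have : circleLift φ = fun t => c * p t := funext hφ
    change Continuous (circleLift φ)
    rw [this]
    exact continuous_const.mul D.continuous)
  have h0 : ∀ x, 0 ≤ φ x := forall_circle.2 fun t => by
    have := hφ t
    rw [circleLift] at this
    rw [this]
    exact (mul_pos hc (D.pos t)).le
  have hfin := isFiniteMeasure_densityMeasure hcont
  have hmass : (densityMeasure φ).real univ = c := by
    have := integral_densityMeasure hcont h0 fun _ => 1
    rw [integral_const, smul_eq_mul, mul_one] at this
    rw [this]
    have e : ∀ t, circleLift φ t * circleLift (fun _ => 1) t = c * p t := fun t => by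
      rw [hφ, circleLift, mul_one]
    simp only [e]
    rw [intervalIntegral.integral_const_mul, D.mass, mul_one]
  rw [couplingMap, hmass, integral_densityMeasure hcont h0, ← AddCircle.coe_add, D.meanField_eq]
  congr 2
  have e1 : ∀ s, circleLift φ s * circleLift (fun y => H (t : UnitAddCircle) y) s
      = c * (H (t : UnitAddCircle) (s : UnitAddCircle) * p s) := fun s => by
    rw [hφ, circleLift]
    ring
  have e2 : ∀ s, torusKernel H δ 0 t s * p s
      = δ * (H (t : UnitAddCircle) (s : UnitAddCircle) * p s) := fun s => by
    simp only [torusKernel, Function.iterate_zero, id]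
    ring
  simp only [e1, e2]
  rw [intervalIntegral.integral_const_mul, intervalIntegral.integral_const_mul,
    mul_div_cancel_left₀ _ hc.ne']

theorem sto_densityMeasure (hK : KernelBounds (torusKernel H δ) N Θ)
    (hs : SmallParam k N Θ a lam) (hc : 0 < c) (D : LineDensity a α p)
    (hφ : ∀ t, circleLift φ t = c * p t)
    (hψ : ∀ t, circleLift ψ t = c * lineOp k (torusKernel H δ) p t) :
    sto (multMap k) H δ (densityMeasure φ) = densityMeasure ψ := by
  have hk0 : 0 < k := by have := hs.one_lt; omega
  have S := D.smallShift hK hs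
  have hφc : Continuous φ := continuous_of_comp_coe (by
    change Continuous (circleLift φ)
    rw [funext hφ]
    exact continuous_const.mul D.continuous)
  have hTc : Continuous (lineOp k (torusKernel H δ) p) :=
    continuous_iff_continuousAt.2 fun x => (D.hasDerivAt_lineOp hK hs x).continuousAt
  have hψc : Continuous ψ := continuous_of_comp_coe (by
    change Continuous (circleLift ψ)
    rw [funext hψ]
    exact continuous_const.mul hTc)
  have hφ0 : ∀ x, 0 ≤ φ x := forall_circle.2 fun t =>
    (mul_pos hc (D.pos t)).le.trans_eq (hφ t).symm
  have hψ0 : ∀ x, 0 ≤ ψ x := forall_circle.2 fun t => by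
    refine le_trans ?_ (hψ t).symm.le
    exact mul_nonneg hc.le (le_trans (by norm_num) (D.le_lineOp hK hs t))
  have hg : Continuous (couplingMap H δ (densityMeasure φ)) := continuous_of_comp_coe (by
    simp only [couplingMap_coe hc D hφ]
    exact (AddCircle.continuous_mk' 1).comp (continuous_id.add S.continuous))
  have hf : Continuous (multMap k) := continuous_nsmul k
  have := isFiniteMeasure_densityMeasure hφc
  have := isFiniteMeasure_densityMeasure hψc
  have : IsFiniteMeasure (sto (multMap k) H δ (densityMeasure φ)) := by
    unfold sto
    infer_instance
  -- Finite measures are compared on bounded continuous functions, where the two push-forwards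
  -- become the two changes of variables on the line.
  refine ext_of_forall_integral_eq_of_IsFiniteMeasure fun F => ?_
  rw [sto, integral_map hf.measurable.aemeasurable F.continuous.aestronglyMeasurable,
    integral_map (f := fun x => F (multMap k x)) hg.measurable.aemeasurable
      (F.continuous.comp hf).aestronglyMeasurable,
    integral_densityMeasure hφc hφ0, integral_densityMeasure hψc hψ0]
  have hFl : Continuous (circleLift F) := F.continuous.comp (AddCircle.continuous_mk' 1)
  have hmul : ∀ s : ℝ, multMap k (s : UnitAddCircle) = ((k * s : ℝ) : UnitAddCircle) := fun s => by
    rw [multMap, ← AddCircle.coe_nsmul, nsmul_eq_mul]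
  have e1 : ∀ t, circleLift φ t * circleLift
      (fun x => F (multMap k (couplingMap H δ (densityMeasure φ) x))) t
      = c * (circleLift F (k * (t + meanField (torusKernel H δ 0) p t)) * p t) := fun t => by
    rw [hφ, circleLift, couplingMap_coe hc D hφ, hmul, circleLift]
    ring
  have e2 : ∀ t, circleLift ψ t * circleLift F t
      = c * (circleLift F t * lineOp k (torusKernel H δ) p t) := fun t => by
    rw [hψ]
    ring
  simp only [e1, e2]
  rw [intervalIntegral.integral_const_mul, intervalIntegral.integral_const_mul]
  congr 1
  have hFk : ∀ s : ℝ, circleLift F (k * (s + 1)) = circleLift F (k * s) := fun s => by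
    simp only [circleLift]
    rw [← hmul, ← hmul]
    simp
  rw [S.integral_comp_shift (F := fun s => circleLift F (k * s))
    (hFl.comp (continuous_const.mul continuous_id)) D.continuous hFk D.periodic]
  have hG : Continuous fun x => shiftDensity p (meanField (torusKernel H δ 1) p)
      (invShift (meanField (torusKernel H δ 0) p) x) :=
    (D.continuous.div (continuous_const.add S.continuous_deriv)
      fun t => (S.one_add_pos t).ne').comp S.continuous_invShift
  exact (integral_mul_branchAvg hk0 hFl hG (circleLift_add_one F)).symm

/-- The density of the image measure is given by the lifted operator. -/
theorem circleLift_stoDensity (hK : KernelBounds (torusKernel H δ) N Θ)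
    (hs : SmallParam k N Θ a lam) (hc : 0 < c) (D : LineDensity a α p)
    (hφ : ∀ t, circleLift φ t = c * p t) (t : ℝ) :
    circleLift (stoDensity (multMap k) H δ φ) t = c * lineOp k (torusKernel H δ) p t := by
  have hper : Function.Periodic (fun t => c * lineOp k (torusKernel H δ) p t) 1 := fun t => by
    simp only [D.lineOp_periodic hK hs]
  set ψ : UnitAddCircle → ℝ := hper.lift with hψdef
  have hψ : ∀ t, circleLift ψ t = c * lineOp k (torusKernel H δ) p t := fun t =>
    hper.lift_coe t
  have hTc : Continuous (lineOp k (torusKernel H δ) p) :=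
    continuous_iff_continuousAt.2 fun x => (D.hasDerivAt_lineOp hK hs x).continuousAt
  have hψc : Continuous ψ := continuous_of_comp_coe (by
    change Continuous (circleLift ψ)
    rw [funext hψ]
    exact continuous_const.mul hTc)
  have hψ0 : ∀ x, 0 ≤ ψ x := forall_circle.2 fun t => by
    refine le_trans ?_ (hψ t).symm.le
    exact mul_nonneg hc.le (le_trans (by norm_num) (D.le_lineOp hK hs t))
  have hspec := sto_densityMeasure hK hs hc D hφ hψ
  obtain ⟨h1, h2, h3⟩ := Classical.epsilon_spec
    (p := fun ψ : UnitAddCircle → ℝ => Continuous ψ ∧ (∀ x, 0 ≤ ψ x) ∧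
      sto (multMap k) H δ (densityMeasure φ) = densityMeasure ψ) ⟨ψ, hψc, hψ0, hspec⟩
  have : stoDensity (multMap k) H δ φ = ψ :=
    densityMeasure_injective h1 hψc h2 hψ0 (h3.symm.trans hspec)
  rw [this, hψ]

end Measure

/-! ### Contraction and attraction on the circle -/

section Contraction

/-- The total mass of a function on the circle. -/
noncomputable def circleMass (φ : UnitAddCircle → ℝ) : ℝ := ∫ t in (0 : ℝ)..1, circleLift φ t

variable {k : ℕ} {H : UnitAddCircle → UnitAddCircle → ℝ} {δ N Θ a α lam c d β : ℝ}
  {φ ψ : UnitAddCircle → ℝ} {p q : ℝ → ℝ}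

theorem exists_lineDensity (ha : 0 ≤ a) (h : φ ∈ logLipCone a ∩ secondDerivCone α) :
    0 < circleMass φ ∧
      ∃ p, LineDensity a α p ∧ circleLift φ = fun t => circleMass φ * p t := by
  obtain ⟨h1, h2⟩ := h
  obtain ⟨-, hpos, hd1⟩ := (mem_logLipCone_iff ha).1 h1
  obtain ⟨hC, -, hd2⟩ := mem_secondDerivCone_iff.1 h2
  have hm : 0 < circleMass φ :=
    intervalIntegral.intervalIntegral_pos_of_pos (hC.continuous.intervalIntegrable _ _) hpos
      zero_lt_one
  have e1 : deriv (fun t => (circleMass φ)⁻¹ * circleLift φ t)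
      = fun t => (circleMass φ)⁻¹ * deriv (circleLift φ) t := by
    funext t
    exact deriv_const_mul _ (hC.differentiable (by norm_num) t)
  have hC1 : ContDiff ℝ 1 (deriv (circleLift φ)) :=
    ((contDiff_succ_iff_deriv (n := 1)).1 hC).2.2
  have hinv : 0 < (circleMass φ)⁻¹ := inv_pos.2 hm
  refine ⟨hm, fun t => (circleMass φ)⁻¹ * circleLift φ t, ⟨contDiff_const.mul hC, fun t => ?_,
    fun t => mul_pos hinv (hpos t), fun t => ?_, fun t => ?_, ?_⟩, ?_⟩
  · rw [circleLift_add_one]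
  · rw [e1, abs_mul, abs_of_pos hinv, mul_left_comm]
    exact mul_le_mul_of_nonneg_left (hd1 t) hinv.le
  · rw [e1, deriv_const_mul _ (hC1.differentiable (by norm_num) t), abs_mul, abs_of_pos hinv,
      mul_left_comm]
    exact mul_le_mul_of_nonneg_left (hd2 t) hinv.le
  · rw [intervalIntegral.integral_const_mul]
    exact inv_mul_cancel₀ hm.ne'
  · funext t
    rw [mul_inv_cancel_left₀ hm.ne']

theorem LineDensity.mem (ha : 0 ≤ a) (hc : 0 < c) (D : LineDensity a α p)
    (hφ : circleLift φ = fun t => c * p t) : φ ∈ logLipCone a ∩ secondDerivCone α := by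
  have hC : ContDiff ℝ 2 (circleLift φ) := by
    rw [hφ]
    exact contDiff_const.mul D.contDiff
  have e1 : deriv (circleLift φ) = fun t => c * deriv p t := by
    rw [hφ]
    exact funext fun t => ((D.hasDerivAt t).const_mul c).deriv
  have e2 : deriv (deriv (circleLift φ)) = fun t => c * deriv (deriv p) t := by
    rw [e1]
    exact funext fun t => ((D.hasDerivAt_deriv t).const_mul c).deriv
  have hpos : ∀ t, 0 < circleLift φ t := fun t => by
    rw [hφ]
    exact mul_pos hc (D.pos t)
  refine ⟨(mem_logLipCone_iff ha).2 ⟨hC.of_le (by norm_num), hpos, fun t => ?_⟩,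
    mem_secondDerivCone_iff.2 ⟨hC, hpos, fun t => ?_⟩⟩
  · rw [e1, hφ, abs_mul, abs_of_pos hc, mul_left_comm]
    exact mul_le_mul_of_nonneg_left (D.abs_deriv_le t) hc.le
  · rw [e2, hφ, abs_mul, abs_of_pos hc, mul_left_comm]
    exact mul_le_mul_of_nonneg_left (D.abs_deriv_deriv_le t) hc.le

/-- For densities of mass `c` and `d`, the order relation with `β` is that of the normalised
densities with `β * d / c`. -/
theorem coneLE_smul_iff (ha : 0 ≤ a) (hc : 0 < c) (D : LineDensity a α p)
    (D' : LineDensity a α q) (hφ : circleLift φ = fun t => c * p t)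
    (hψ : circleLift ψ = fun t => d * q t) :
    ConeLE (logLipCone a) (β • ψ) φ ↔ ∀ t, 0 < p t - β * d / c * q t ∧
      |deriv p t - β * d / c * deriv q t| ≤ a * (p t - β * d / c * q t) := by
  have e : circleLift (φ - β • ψ) = fun t => c * (p t - β * d / c * q t) := by
    funext t
    change circleLift φ t - β * circleLift ψ t = _
    rw [hφ, hψ]
    field_simp
  have e1 : deriv (circleLift (φ - β • ψ))
      = fun t => c * (deriv p t - β * d / c * deriv q t) := by
    rw [e]
    exact funext fun t =>
      (((D.hasDerivAt t).sub ((D'.hasDerivAt t).const_mul _)).const_mul c).deriv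
  have hC : ContDiff ℝ 1 (circleLift (φ - β • ψ)) := by
    rw [e]
    exact contDiff_const.mul ((D.contDiff.of_le (by norm_num)).sub
      (contDiff_const.mul (D'.contDiff.of_le (by norm_num))))
  rw [ConeLE, mem_logLipCone_iff ha, and_iff_right hC, ← forall_and]
  refine forall_congr' fun t => ?_
  rw [e1, e]
  simp only
  rw [abs_mul, abs_of_pos hc, mul_left_comm a, mul_le_mul_iff_right₀ hc, mul_pos_iff_of_pos_left hc]

/-- Integrate the strict inequality between two probability densities. -/
theorem ratio_lt_one (D : LineDensity a α p) (D' : LineDensity a α q) {b : ℝ}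
    (h : ∀ t, 0 < p t - b * q t) : b < 1 := by
  have hc : Continuous fun t => p t - b * q t := D.continuous.sub (continuous_const.mul D'.continuous)
  have h1 := intervalIntegral.intervalIntegral_pos_of_pos (hc.intervalIntegrable 0 1) h zero_lt_one
  rw [intervalIntegral.integral_sub (D.continuous.intervalIntegrable _ _)
    ((D'.continuous.const_mul b).intervalIntegrable _ _), intervalIntegral.integral_const_mul,
    D.mass, D'.mass] at h1
  linarith

theorem le_circleMass_div (ha : 0 ≤ a) (hφ : φ ∈ logLipCone a ∩ secondDerivCone α)
    (hψ : ψ ∈ logLipCone a ∩ secondDerivCone α)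
    (h : ConeLE (logLipCone a) (β • ψ) φ) : β ≤ circleMass φ / circleMass ψ := by
  obtain ⟨hc, p, D, ep⟩ := exists_lineDensity ha hφ
  obtain ⟨hd, q, D', eq⟩ := exists_lineDensity ha hψ
  have h1 := (coneLE_smul_iff ha hc D D' ep eq).1 h
  have h2 := ratio_lt_one D D' fun t => (h1 t).1
  rw [div_lt_one hc] at h2
  exact (le_div_iff₀ hd).2 h2.le

theorem coneLE_stoDensity (hK : KernelBounds (torusKernel H δ) N Θ)
    (hs : SmallParam k N Θ a lam)
    (hφ : φ ∈ logLipCone a ∩ secondDerivCone ((4 * N + 1) * a))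
    (hψ : ψ ∈ logLipCone a ∩ secondDerivCone ((4 * N + 1) * a)) (hβ : 0 ≤ β)
    (h : ConeLE (logLipCone a) (β • ψ) φ) :
    ConeLE (logLipCone a)
      ((β + (1 - lam) / 5 * (circleMass φ / circleMass ψ - β)) • stoDensity (multMap k) H δ ψ)
      (stoDensity (multMap k) H δ φ) := by
  have ha := hs.a_pos.le
  obtain ⟨hc, p, D, ep⟩ := exists_lineDensity ha hφ
  obtain ⟨hd, q, D', eq⟩ := exists_lineDensity ha hψ
  have h1 := (coneLE_smul_iff ha hc D D' ep eq).1 h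
  rw [coneLE_smul_iff ha hc (D.lineOp_lineDensity hK hs) (D'.lineOp_lineDensity hK hs)
    (funext (circleLift_stoDensity hK hs hc D (congrFun ep)))
    (funext (circleLift_stoDensity hK hs hd D' (congrFun eq)))]
  have e : (β + (1 - lam) / 5 * (circleMass φ / circleMass ψ - β)) * circleMass ψ / circleMass φ
      = β * circleMass ψ / circleMass φ
        + (1 - lam) / 5 * (1 - β * circleMass ψ / circleMass φ) := by
    field_simp
  rw [e]
  exact D.lineOp_improve hK hs D' (by positivity) (ratio_lt_one D D' fun t => (h1 t).1)
    (fun t => (h1 t).1) fun t => (h1 t).2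

theorem mapsTo_stoDensity (hK : KernelBounds (torusKernel H δ) N Θ)
    (hs : SmallParam k N Θ a lam) :
    MapsTo (stoDensity (multMap k) H δ) (logLipCone a ∩ secondDerivCone ((4 * N + 1) * a))
      (logLipCone a ∩ secondDerivCone ((4 * N + 1) * a)) := by
  intro φ hφ
  obtain ⟨hc, p, D, ep⟩ := exists_lineDensity hs.a_pos.le hφ
  exact (D.lineOp_lineDensity hK hs).mem hs.a_pos.le hc
    (funext (circleLift_stoDensity hK hs hc D (congrFun ep)))

/-- Improving from `β = 0`, which only requires membership in the cone, already produces a positive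
multiple in each direction. -/
theorem hilbertDist_stoDensity_lt_top (hK : KernelBounds (torusKernel H δ) N Θ)
    (hs : SmallParam k N Θ a lam)
    (hφ : φ ∈ logLipCone a ∩ secondDerivCone ((4 * N + 1) * a))
    (hψ : ψ ∈ logLipCone a ∩ secondDerivCone ((4 * N + 1) * a)) :
    hilbertDist (logLipCone a) (stoDensity (multMap k) H δ φ) (stoDensity (multMap k) H δ ψ)
      < ⊤ := by
  have ha := hs.a_pos.le
  have hκ : 0 < (1 - lam) / 5 := by linarith [hs.lam_lt]
  have hc := (exists_lineDensity ha hφ).1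
  have hd := (exists_lineDensity ha hψ).1
  have h1 := coneLE_stoDensity (β := 0) hK hs hφ hψ le_rfl (by simpa [ConeLE] using hφ.1)
  have h2 := coneLE_stoDensity (β := 0) hK hs hψ hφ le_rfl (by simpa [ConeLE] using hψ.1)
  exact hilbertDist_lt_top (smul_mem_logLipCone ha) (by rw [zero_add, sub_zero]; positivity)
    (by rw [zero_add, sub_zero]; positivity) h1 h2

theorem lineDensity_one (ha : 0 ≤ a) (hα : 0 ≤ α) : LineDensity a α fun _ => 1 where
  contDiff := contDiff_const
  periodic _ := rfl
  pos _ := one_pos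
  abs_deriv_le t := by simpa using ha
  abs_deriv_deriv_le t := by simpa using hα
  mass := by simp

/-- The mean-zero condition passes to `∂₁ H`, so the coupling by the uniform density has Jacobian
`1`. -/
theorem lineOp_one {K : ℕ → ℝ → ℝ → ℝ} (hK : KernelBounds K N Θ) (hk : 0 < k) (x : ℝ) :
    lineOp k K (fun _ => 1) x = 1 := by
  have hk' : (k : ℝ) ≠ 0 := by positivity
  have h1 : ∀ t, meanField (K 1) (fun _ => 1) t = 0 := fun t => by
    simp only [meanField, mul_one, hK.mean_zero 1 (by norm_num), zero_div]
  simp only [lineOp, branchAvg, shiftDensity, h1]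
  simp [hk']

theorem stoDensity_one (hK : KernelBounds (torusKernel H δ) N Θ)
    (hs : SmallParam k N Θ a lam) :
    stoDensity (multMap k) H δ (fun _ => 1) = fun _ => 1 := by
  funext x
  induction x using QuotientAddGroup.induction_on with | _ t => ?_
  have := circleLift_stoDensity (φ := fun _ => 1) (p := fun _ => 1) hK hs one_pos
    (lineDensity_one hs.a_pos.le hs.a_pos.le) (fun t => by simp [circleLift]) t
  rwa [lineOp_one hK (by have := hs.one_lt; omega), mul_one] at this

theorem densityMeasure_one : densityMeasure (fun _ => 1) = volume := by
  simp only [densityMeasure, ENNReal.ofReal_one]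
  exact withDensity_one

theorem sto_volume (hK : KernelBounds (torusKernel H δ) N Θ) (hs : SmallParam k N Θ a lam) :
    sto (multMap k) H δ (volume : Measure UnitAddCircle) = volume := by
  have := sto_densityMeasure (φ := fun _ => 1) (ψ := fun _ => 1) (p := fun _ => 1) hK hs one_pos
    (lineDensity_one hs.a_pos.le hs.a_pos.le) (fun t => by simp [circleLift])
    (fun t => by rw [lineOp_one hK (by have := hs.one_lt; omega)]; simp [circleLift])
  rwa [densityMeasure_one] at this

theorem isHilbertContractionOn_stoDensity (hK : KernelBounds (torusKernel H δ) N Θ)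
    (hs : SmallParam k N Θ a lam) :
    IsHilbertContractionOn (logLipCone a) (logLipCone a ∩ secondDerivCone ((4 * N + 1) * a))
      (stoDensity (multMap k) H δ) := by
  have ha := hs.a_pos.le
  exact isHilbertContractionOn_of_improve (κ := (1 - lam) / 5) (by linarith [hs.lam_lt])
    (by linarith [hs.lam_nonneg]) (smul_mem_logLipCone ha) circleMass
    (fun φ hφ => (exists_lineDensity ha hφ).1) (mapsTo_stoDensity hK hs)
    (fun φ hφ ψ hψ β _ h => le_circleMass_div ha hφ hψ h)
    (fun φ hφ ψ hψ β hβ h => coneLE_stoDensity hK hs hφ hψ hβ.le h)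

end Contraction

end SelfConsistent

open SelfConsistent in
theorem proposition4p6 (k : ℕ) (hk : 1 < k)
    (H : UnitAddCircle → UnitAddCircle → ℝ) (hH : TorusContDiff 3 H)
    (hmean : ∀ x : UnitAddCircle, ∫ y : UnitAddCircle, H x y = 0)
    (δ : ℝ)
    (hδ : |δ| * max (⨆ x : UnitAddCircle, partialNorm H 1 x)
        (⨆ x : UnitAddCircle, partialNorm H 2 x) < 2 * ((k : ℝ) - 1)) :
    -- Lebesgue measure is a fixed point
    sto (multMap k) H δ (volume : Measure UnitAddCircle) = volume ∧
    stoDensity (multMap k) H δ (fun _ => 1) = (fun _ => 1) ∧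
    -- there are arbitrarily small `a₀, α₀` such that ...
    ∀ ε : ℝ, 0 < ε → ∃ a₀ α₀ : ℝ, 0 < a₀ ∧ a₀ < ε ∧ 0 < α₀ ∧ α₀ < ε ∧
      -- on `𝒱_{a₀} ∩ 𝒞_{α₀}` the operator on densities really is the density of the image measure
      (∀ φ ∈ logLipCone a₀ ∩ secondDerivCone α₀,
        sto (multMap k) H δ (densityMeasure φ)
          = densityMeasure (stoDensity (multMap k) H δ φ)) ∧
      -- it is a contraction for the Hilbert metric of `𝒱_{a₀}`
      IsHilbertContractionOn (logLipCone a₀) (logLipCone a₀ ∩ secondDerivCone α₀)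
        (stoDensity (multMap k) H δ) ∧
      -- the Lebesgue density attracts `𝒱_{a₀} ∩ 𝒞_{α₀}`
      (fun _ => 1) ∈ logLipCone a₀ ∩ secondDerivCone α₀ ∧
      ∀ φ ∈ logLipCone a₀ ∩ secondDerivCone α₀,
        Tendsto (fun n : ℕ => hilbertDist (logLipCone a₀)
          ((stoDensity (multMap k) H δ)^[n] φ) (fun _ => 1)) atTop (𝓝 0) := by
  obtain ⟨N, hK⟩ := exists_kernelBounds hH hmean δ
  obtain ⟨lam, hlam⟩ := exists_eventually_smallParam (N := N) hk hK.l1_nonneg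
    ((mul_le_mul_of_nonneg_left (le_max_right _ _) (abs_nonneg δ)).trans_lt hδ)
  obtain ⟨a', hs'⟩ := hlam.exists
  refine ⟨sto_volume hK hs', stoDensity_one hK hs', fun ε hε => ?_⟩
  have e1 : ∀ᶠ a in 𝓝[>] (0 : ℝ), a < ε := (eventually_lt_nhds hε).filter_mono nhdsWithin_le_nhds
  have e2 : ∀ᶠ a in 𝓝[>] (0 : ℝ), (4 * N + 1) * a < ε :=
    (((continuous_const.mul continuous_id).tendsto 0).eventually_lt_const
      (by simpa using hε)).filter_mono nhdsWithin_le_nhds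
  -- Both cone parameters are proportional to `a`, so a single small `a` meets every requirement.
  obtain ⟨a, hs, h1, h2⟩ := (hlam.and (e1.and e2)).exists
  have ha := hs.a_pos
  have hα : 0 < (4 * N + 1) * a := by
    have := hK.nonneg
    positivity
  have hone : (fun _ => 1) ∈ logLipCone a ∩ secondDerivCone ((4 * N + 1) * a) :=
    (lineDensity_one ha.le hα.le).mem ha.le one_pos (by funext t; simp [circleLift])
  have hT := isHilbertContractionOn_stoDensity hK hs
  refine ⟨a, (4 * N + 1) * a, ha, h1, hα, h2, fun φ hφ => ?_, hT, hone, fun φ hφ => ?_⟩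
  · obtain ⟨hc, p, D, ep⟩ := exists_lineDensity ha.le hφ
    exact sto_densityMeasure hK hs hc D (congrFun ep)
      (circleLift_stoDensity hK hs hc D (congrFun ep))
  · exact tendsto_hilbertDist_iterate (smul_mem_logLipCone ha.le) circleMass
      (fun φ hφ => (exists_lineDensity ha.le hφ).1)
      (fun φ hφ ψ hψ β _ h => le_circleMass_div ha.le hφ hψ h) hT
      (fun φ hφ ψ hψ => hilbertDist_stoDensity_lt_top hK hs hφ hψ) hone (stoDensity_one hK hs) hφ
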